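/- Let $R$ be a field, let $c\in M_n(R)$ and $d\in M_m(R)$, and let $S_n(c,R)=\{x\in M_n(R)\mid cx=xc\}$ be the centralizer algebra of $c$ (similarly $S_m(d,R)$). *$Sg$-equivalence.* Let $\mathcal E_c$ be the set of elementary divisors of $c$ (monic prime powers in $R[x]$), and let $\mathcal M_c\subseteq\mathcal E_c$ be the set of those that are maximal with respect to divisibility. For $f\in\mathcal M_c$ let $P_c(f)$ be the set of all $i\ge 1$ such that $p^i\in\mathcal E_c$ for some irreducible $p\mid f$. Let $\mathcal I_c$ be the set of monic irreducible $f\in R[x]$ such that $f^i\in\mathcal M_c$ for some $i$ with $|P_c(f^i)|\ne\max P_c(f^i)$, and put $P_c(f):=P_c(f^i)$ for such $f$. For a finite set $T=\{m_1>m_2>\cdots>m_s\}$ of positive integers let $\mathcal D_T$ be the multiset obtained from $\{\{m_1-m_2,\dots,m_{s-1}-m_s,m_s\}\}$ by removing all $1$'s. Partition $\mathcal I_c$ into the classes $\mathcal I_{c,1},\dots,\mathcal I_{c,r_c}$ of the equivalence relation $f\sim g:\Leftrightarrow R[x]/(f)\simeq R[x]/(g)$ as $R$-algebras; let $\mathcal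 D_{c,i}$ be the multiset union (multiplicities added) of the $\mathcal D_{P_c(f)}$ with $f\in\mathcal I_{c,i}$, and let $Q_{c,i}:=R[x]/(p_{c,i})$ with $p_{c,i}\in\mathcal I_{c,i}$. Then $c$ and $d$ are *$Sg$-equivalent* if $r_c=r_d$ and there is a permutation $\sigma$ of $\{1,\dots,r_c\}$ such that $Q_{c,i}\simeq Q_{d,\sigma(i)}$ as $R$-algebras and $\mathcal D_{c,i}=\mathcal D_{d,\sigma(i)}$ for all $i$. *Quasi-hereditary algebras.* A two-sided ideal $J$ of a finite-dimensional algebra $A$ is a *heredity ideal* if $J^2=J$, $J\,\mathrm{rad}(A)\,J=0$, and $J$ is projective as a left $A$-module; $A$ is *quasi-hereditary* if there is a finite chain $0=J_0\subseteq J_1\subseteq\cdots\subseteq J_k=A$ of two-sided ideals such that $J_j/J_{j-1}$ is a heredity ideal of $A/J_{j-1}$ for all $1\le j\le k$. *Cartan determinant.* If $S_1,\dots,S_k$ is a complete set of pairwise non-isomorphic simple left $A$-modules and $P_i$ is the projective cover of $S_i$, the *Cartan determinant* of $A$ is $\det\big([P_i:S_j]\big)_{i,j}$, where $[P_i:S_j]$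 is the number of composition factors of $P_i$ isomorphic to $S_j$. **Corollary.** If $c$ and $d$ are $Sg$-equivalent, then (1) $S_n(c,R)$ is quasi-hereditary if and only if $S_m(d,R)$ is quasi-hereditary; (2) the Cartan determinants of $S_n(c,R)$ and $S_m(d,R)$ are equal. -/

import Mathlib

open Polynomial
open scoped DirectSum

namespace CentralizerMatrix

universe u v

/-! ### Quasi-hereditary algebras

A left ideal `J : Ideal A` with `J.IsTwoSided` is a two-sided ideal. -/

section QuasiHereditary

/-- `J` is a heredity ideal of `A`: a two-sided ideal with `J² = J` and `J · rad(A) · J = 0`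
which is projective as a left `A`-module.  (For an idempotent ideal `J` of a finite-dimensional
algebra with `J · rad(A) · J = 0`, being projective on the left and being projective on the right
are the same.) -/
def IsHeredityIdeal {A : Type u} [Ring A] (J : Ideal A) : Prop :=
  J.IsTwoSided ∧ J * J = J ∧ J * Ring.jacobson A * J = ⊥ ∧ Module.Projective A J

/-- There is a finite chain `0 = J₀ ⊆ J₁ ⊆ ⋯ ⊆ Jₙ = A` of two-sided ideals such that `Jᵢ₊₁ / Jᵢ` is
a heredity ideal of `A / Jᵢ` for all `i < n`.  (The values of `J` beyond `n` play no role.) -/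
def IsQuasiHereditary (A : Type u) [Ring A] : Prop :=
  ∃ (n : ℕ) (J : ℕ → Ideal A) (_ : ∀ i, (J i).IsTwoSided),
    J 0 = ⊥ ∧ J n = ⊤ ∧
      ∀ i < n, J i ≤ J (i + 1) ∧ IsHeredityIdeal ((J (i + 1)).map (Ideal.Quotient.mk (J i)))

end QuasiHereditary

/-! ### The Cartan matrix of an Artinian ring -/

section Cartan

variable (A : Type u) [Ring A]

/-- Isomorphism of the simple left modules `A ⧸ I` given by maximal left ideals `I`. -/
def simpleSetoid : Setoid {I : Submodule A A // IsCoatom I} where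
  r I J := Nonempty ((A ⧸ I.1) ≃ₗ[A] (A ⧸ J.1))
  iseqv := ⟨fun _ => ⟨LinearEquiv.refl _ _⟩, fun ⟨e⟩ => ⟨e.symm⟩, fun ⟨e⟩ ⟨f⟩ => ⟨e.trans f⟩⟩

/-- The isomorphism classes of simple left `A`-modules; every simple module is isomorphic to
`A ⧸ I` for a maximal left ideal `I`. -/
def SimpleClass : Type u := Quotient (simpleSetoid A)

variable {A}

/-- The maximal left ideal `I` of the chosen representative `A ⧸ I` of a class of simple modules. -/
noncomputable def SimpleClass.ideal (S : SimpleClass A) : Submodule A A :=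
  (Quotient.out (s := simpleSetoid A) S).1

theorem SimpleClass.isCoatom_ideal (S : SimpleClass A) : IsCoatom S.ideal :=
  (Quotient.out (s := simpleSetoid A) S).2

variable (A) in
theorem finite_simpleClass [IsArtinianRing A] : Finite (SimpleClass A) := by
  classical
  obtain ⟨s, hs0, hs1⟩ := exists_compositionSeries_of_isNoetherian_isArtinian A A
  have key : ∀ I : {I : Submodule A A // IsCoatom I}, ∃ i : Fin s.length,
      Nonempty ((A ⧸ I.1) ≃ₗ[A]
        (s i.succ ⧸ (s i.castSucc).comap (s i.succ).subtype)) := by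
    rintro ⟨I, hI⟩
    have hex : ∃ i : Fin s.length, s i.castSucc ≤ I ∧ ¬ s i.succ ≤ I := by
      by_contra hcon
      push Not at hcon
      have : ∀ j : Fin (s.length + 1), s j ≤ I := by
        intro j
        induction j using Fin.induction with
        | zero => change s.head ≤ I; rw [hs0]; exact bot_le
        | succ j ih => exact hcon j ih
      have h := this (Fin.last _)
      change s.last ≤ I at h
      rw [hs1] at h
      exact hI.1 (top_le_iff.mp h)
    obtain ⟨i, h1, h2⟩ := hex
    refine ⟨i, ?_⟩
    have hcov : s i.castSucc ⋖ s i.succ := s.step i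
    let f : s i.succ →ₗ[A] (A ⧸ I) := I.mkQ ∘ₗ (s i.succ).subtype
    have hker : LinearMap.ker f = (s i.castSucc).comap (s i.succ).subtype := by
      have hk : LinearMap.ker f = I.comap (s i.succ).subtype := by
        rw [LinearMap.ker_comp, Submodule.ker_mkQ]
      have hinf : s i.succ ⊓ I = s i.castSucc := by
        rcases hcov.eq_or_eq (le_inf hcov.le h1) inf_le_left with h | h
        · exact h
        · exact absurd (inf_eq_left.mp h) h2
      rw [hk, ← hinf]
      ext x
      simp
    have hsurj : Function.Surjective f := by
      rw [← LinearMap.range_eq_top, LinearMap.range_comp, Submodule.range_subtype]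
      have hsup : s i.succ ⊔ I = ⊤ := hI.2 _ (lt_of_le_of_ne le_sup_right
        (fun h => h2 (by rw [h]; exact le_sup_left)))
      have := congrArg (Submodule.map I.mkQ) hsup
      rw [Submodule.map_sup, Submodule.mkQ_map_self, sup_bot_eq, Submodule.map_top,
        Submodule.range_mkQ] at this
      exact this
    exact ⟨((Submodule.quotEquivOfEq _ _ hker.symm).trans
      (f.quotKerEquivOfSurjective hsurj)).symm⟩
  choose g hg using key
  refine Finite.of_injective (fun S : SimpleClass A => g (Quotient.out (s := simpleSetoid A) S)) ?_
  intro S T hST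
  have h1 := hg (Quotient.out (s := simpleSetoid A) S)
  have h2 := hg (Quotient.out (s := simpleSetoid A) T)
  simp only at hST
  rw [← hST] at h2
  obtain ⟨e⟩ := h1
  obtain ⟨f⟩ := h2
  have : (simpleSetoid A).r (Quotient.out (s := simpleSetoid A) S)
      (Quotient.out (s := simpleSetoid A) T) := ⟨e.trans f.symm⟩
  have h3 := Quotient.sound (s := simpleSetoid A) this
  exact (Quotient.out_eq (s := simpleSetoid A) S).symm.trans
    (h3.trans (Quotient.out_eq (s := simpleSetoid A) T))

noncomputable instance [IsArtinianRing A] : Fintype (SimpleClass A) :=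
  haveI := finite_simpleClass A
  Fintype.ofFinite _

noncomputable instance : DecidableEq (SimpleClass A) := Classical.decEq _

/-- `π : P → S` is a projective cover: `P` is projective, `π` is surjective and `ker π` is
superfluous in `P`. -/
def IsProjectiveCover {P : Type v} {S : Type u} [AddCommGroup P] [Module A P] [AddCommGroup S]
    [Module A S] (π : P →ₗ[A] S) : Prop :=
  Module.Projective A P ∧ Function.Surjective π ∧
    ∀ N : Submodule A P, N ⊔ LinearMap.ker π = ⊤ → N = ⊤

/-- The simple module `A ⧸ I` has a projective cover `P → A ⧸ I` with `P` a left ideal of `A`. -/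
theorem exists_projectiveCover [IsArtinianRing A] (I : Submodule A A) :
    ∃ P : Submodule A A, IsProjectiveCover (I.mkQ ∘ₗ P.subtype) := by
  have hne : {P : Submodule A A | Module.Projective A P ∧
      Function.Surjective (I.mkQ ∘ₗ P.subtype)}.Nonempty := by
    refine ⟨⊤, Module.Projective.of_equiv (Submodule.topEquiv (R := A) (M := A)).symm, ?_⟩
    intro y
    obtain ⟨a, rfl⟩ := I.mkQ_surjective y
    exact ⟨⟨a, trivial⟩, rfl⟩
  obtain ⟨P, ⟨hP, hsurj⟩, hmin⟩ :=
    (IsWellFounded.wf (r := ((· < ·) : Submodule A A → Submodule A A → Prop))).has_min _ hne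
  refine ⟨P, hP, hsurj, ?_⟩
  intro N hN
  set π := I.mkQ ∘ₗ P.subtype with hπ
  have hNs : Function.Surjective (π ∘ₗ N.subtype) := by
    rw [← LinearMap.range_eq_top, LinearMap.range_comp, Submodule.range_subtype]
    have h := congrArg (Submodule.map π) hN
    rw [Submodule.map_sup, (LinearMap.le_ker_iff_map (p := LinearMap.ker π) (f := π)).mp le_rfl,
      sup_bot_eq, Submodule.map_top, LinearMap.range_eq_top.mpr hsurj] at h
    exact h
  obtain ⟨φ₀, hφ₀⟩ := Module.projective_lifting_property (π ∘ₗ N.subtype) π hNs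
  let φ : Module.End A P := N.subtype ∘ₗ φ₀
  have hφ : ∀ x, π (φ x) = π x := fun x => LinearMap.congr_fun hφ₀ x
  have hφn : ∀ (n : ℕ) x, π ((φ ^ n) x) = π x := by
    intro n
    induction n with
    | zero => intro x; simp
    | succ n ih => intro x; rw [pow_succ', Module.End.mul_apply, hφ, ih]
  obtain ⟨k, hk, hk1⟩ := (φ.eventually_isCompl_ker_pow_range_pow.and
    (Filter.eventually_ge_atTop 1)).exists
  set Q := LinearMap.range (φ ^ k) with hQ
  have hQproj : Module.Projective A Q :=
    Module.Projective.of_split Q.subtype (Submodule.projectionOnto Q _ hk.symm)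
      (by ext x; simp)
  have hQtop : Q.map P.subtype = P := by
    by_contra hne'
    have hle : Q.map P.subtype ≤ P := by
      rintro _ ⟨x, -, rfl⟩
      exact x.2
    refine hmin (Q.map P.subtype) ⟨?_, ?_⟩ (lt_of_le_of_ne hle hne')
    · exact Module.Projective.of_equiv
        (Submodule.equivMapOfInjective P.subtype (Submodule.injective_subtype P) Q)
    · intro y
      obtain ⟨x, rfl⟩ := hsurj y
      exact ⟨⟨P.subtype ((φ ^ k) x), ⟨(φ ^ k) x, ⟨x, rfl⟩, rfl⟩⟩, hφn k x⟩
  have hQN : Q ≤ N := by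
    rintro _ ⟨x, rfl⟩
    obtain ⟨j, rfl⟩ : ∃ j, k = j + 1 := ⟨k - 1, by omega⟩
    rw [pow_succ', Module.End.mul_apply]
    exact (φ₀ _).2
  rw [eq_top_iff]
  intro x _
  have hx : (x : A) ∈ Q.map P.subtype := by rw [hQtop]; exact x.2
  obtain ⟨y, hy, hyx⟩ := hx
  have : y = x := Subtype.ext hyx
  exact hQN (this ▸ hy)

/-- The projective cover of the simple module `S`, realized as a left ideal of `A`. -/
noncomputable def SimpleClass.projCover [IsArtinianRing A] (S : SimpleClass A) : Submodule A A :=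
  Classical.choose (exists_projectiveCover S.ideal)

theorem SimpleClass.isProjectiveCover [IsArtinianRing A] (S : SimpleClass A) :
    IsProjectiveCover (S.ideal.mkQ ∘ₗ S.projCover.subtype) :=
  Classical.choose_spec (exists_projectiveCover S.ideal)

/-- A composition series of a module of finite length. -/
noncomputable def compSeries (A : Type u) [Ring A] (M : Type v) [AddCommGroup M] [Module A M]
    [IsNoetherian A M] [IsArtinian A M] : CompositionSeries (Submodule A M) :=
  Classical.choose (exists_compositionSeries_of_isNoetherian_isArtinian A M)

theorem compSeries_spec (A : Type u) [Ring A] (M : Type v) [AddCommGroup M] [Module A M]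
    [IsNoetherian A M] [IsArtinian A M] :
    (compSeries A M).head = ⊥ ∧ (compSeries A M).last = ⊤ :=
  Classical.choose_spec (exists_compositionSeries_of_isNoetherian_isArtinian A M)

/-- `[M : S]`, the number of composition factors of `M` that are isomorphic to `S`. -/
noncomputable def compMultiplicity (A : Type u) [Ring A] (M : Type v) [AddCommGroup M] [Module A M]
    [IsNoetherian A M] [IsArtinian A M] (S : Type u) [AddCommGroup S] [Module A S] : ℕ :=
  Nat.card {i : Fin (compSeries A M).length //
    Nonempty ((compSeries A M i.succ ⧸
      (compSeries A M i.castSucc).comap (compSeries A M i.succ).subtype) ≃ₗ[A] S)}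

/-- The Cartan matrix of `A`: the rows and columns are indexed by the simple modules, and the entry
at `(S, T)` is `[P(S) : T]` where `P(S)` is the projective cover of `S`. -/
noncomputable def cartanMatrix (A : Type u) [Ring A] [IsArtinianRing A] :
    Matrix (SimpleClass A) (SimpleClass A) ℕ :=
  Matrix.of fun S T => compMultiplicity A S.projCover (A ⧸ T.ideal)

/-- The Cartan determinant of `A`. -/
noncomputable def cartanDet (A : Type u) [Ring A] [IsArtinianRing A] : ℤ :=
  ((cartanMatrix A).map (Nat.cast : ℕ → ℤ)).det

end Cartan

/-! ### Centralizer matrix algebras and the `Sg`-equivalence of matrices -/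

section Matrices

variable {R : Type u} [Field R] {n m : ℕ}

/-- The centralizer matrix algebra `Sₙ(c, R) = {x ∈ Mₙ(R) | c x = x c}`. -/
abbrev centralizerAlgebra (c : Matrix (Fin n) (Fin n) R) :
    Subalgebra R (Matrix (Fin n) (Fin n) R) :=
  Subalgebra.centralizer R {c}

instance (c : Matrix (Fin n) (Fin n) R) : IsArtinianRing (centralizerAlgebra c) :=
  IsArtinianRing.of_finite R _

/-- The `R[x]`-module `Rⁿ` on which `x` acts as `c`. -/
abbrev matrixModule (c : Matrix (Fin n) (Fin n) R) : Type u :=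
  Module.AEval' (Matrix.toLin' c)

/-- The set `𝓔_c` of elementary divisors of `c`: the (monic) prime powers `pᵢ ^ eᵢ` that occur in
a decomposition of the `R[x]`-module `Rⁿ` as a direct sum of modules `R[x] / (pᵢ ^ eᵢ)`.  By the
structure theorem there is such a decomposition, and any two have the same summands. -/
def elementaryDivisors (c : Matrix (Fin n) (Fin n) R) : Set R[X] :=
  {q | ∃ (r : ℕ) (p : Fin r → R[X]) (e : Fin r → ℕ),
    (∀ i, (p i).Monic ∧ Irreducible (p i) ∧ 1 ≤ e i) ∧
    Nonempty (matrixModule c ≃ₗ[R[X]] ⨁ i : Fin r, R[X] ⧸ Ideal.span {p i ^ e i}) ∧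
    ∃ i, q = p i ^ e i}

/-- The set `𝓜_c` of elementary divisors of `c` that are maximal with respect to divisibility. -/
def maxElementaryDivisors (c : Matrix (Fin n) (Fin n) R) : Set R[X] :=
  {f | f ∈ elementaryDivisors c ∧ ∀ g ∈ elementaryDivisors c, f ∣ g → g = f}

theorem dvd_minpoly {c : Matrix (Fin n) (Fin n) R} {q : R[X]} (hq : q ∈ elementaryDivisors c) :
    q ∣ minpoly R (Matrix.toLin' c) := by
  classical
  obtain ⟨r, p, e, -, ⟨φ⟩, i, rfl⟩ := hq
  have hann : ∀ y : matrixModule c, minpoly R (Matrix.toLin' c) • y = 0 := by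
    intro y
    obtain ⟨x, rfl⟩ := (Module.AEval'.of (Matrix.toLin' c)).surjective y
    rw [← Module.AEval.of_aeval_smul, minpoly.aeval]
    simp
  have h := hann (φ.symm (DirectSum.lof R[X] (Fin r)
    (fun i => R[X] ⧸ Ideal.span {p i ^ e i}) i 1))
  rw [← map_smul, LinearEquiv.map_eq_zero_iff, ← map_smul] at h
  have h2 := congrArg (DirectSum.component R[X] (Fin r)
    (fun i => R[X] ⧸ Ideal.span {p i ^ e i}) i) h
  rw [DirectSum.component.lof_self, map_zero] at h2
  rw [← Ideal.mem_span_singleton, ← Ideal.Quotient.eq_zero_iff_mem]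
  rw [← mul_one (minpoly R (Matrix.toLin' c)), map_mul, map_one]
  exact h2

theorem minpoly_ne_zero' (c : Matrix (Fin n) (Fin n) R) : minpoly R (Matrix.toLin' c) ≠ 0 :=
  minpoly.ne_zero (Algebra.IsIntegral.isIntegral _)

theorem finite_powerIndices (c : Matrix (Fin n) (Fin n) R) (f : R[X]) :
    {i : ℕ | 1 ≤ i ∧ ∃ p : R[X], Irreducible p ∧ p ∣ f ∧ p ^ i ∈ elementaryDivisors c}.Finite := by
  refine (Set.finite_Iic (minpoly R (Matrix.toLin' c)).natDegree).subset ?_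
  rintro i ⟨-, p, hp, -, hi⟩
  have h := natDegree_le_of_dvd (dvd_minpoly hi) (minpoly_ne_zero' c)
  rw [natDegree_pow] at h
  exact (Nat.le_mul_of_pos_right i hp.natDegree_pos).trans h

/-- The set `P_c(f)` of power indices of a maximal elementary divisor `f` of `c`: all `i ≥ 1` such
that `p ^ i` is an elementary divisor of `c` for some irreducible `p ∣ f`. -/
noncomputable def powerIndices (c : Matrix (Fin n) (Fin n) R) (f : R[X]) : Finset ℕ :=
  (finite_powerIndices c f).toFinset

/-- The multiset `𝓗_T = {{m₁ - m₂, …, m_{s-1} - m_s, m_s}}` of a set `T = {m₁ > m₂ > ⋯ > m_s}` of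
positive integers: from each `t ∈ T` one subtracts the next smaller element of `T` (and `0` if `t`
is the smallest one). -/
def gaps (T : Finset ℕ) : Multiset ℕ :=
  T.val.map fun t => t - (T.filter (· < t)).sup id

/-- The multiset `𝓓_T`, obtained from `𝓗_T` by removing all `1`s. -/
def nontrivialGaps (T : Finset ℕ) : Multiset ℕ :=
  (gaps T).filter (· ≠ 1)

/-- The set `𝓘_c` of all monic irreducible `f` such that some power `f ^ i` is a maximal elementary
divisor of `c` with `|P_c(f ^ i)| ≠ max P_c(f ^ i)`. -/
def irredSet (c : Matrix (Fin n) (Fin n) R) : Set R[X] :=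
  {f | f.Monic ∧ Irreducible f ∧ ∃ i, f ^ i ∈ maxElementaryDivisors c ∧
    (powerIndices c (f ^ i)).card ≠ (powerIndices c (f ^ i)).sup id}

theorem finite_irredSet (c : Matrix (Fin n) (Fin n) R) : (irredSet c).Finite := by
  classical
  refine (UniqueFactorizationMonoid.normalizedFactors
    (minpoly R (Matrix.toLin' c))).toFinset.finite_toSet.subset ?_
  rintro f ⟨hm, hf, i, hi, -⟩
  have hi0 : i ≠ 0 := by
    rintro rfl
    obtain ⟨r, p, e, hpe, -, j, hj⟩ := hi.1
    rw [pow_zero] at hj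
    have : IsUnit (p j ^ e j) := hj ▸ isUnit_one
    exact (hpe j).2.1.not_isUnit
      ((isUnit_pow_iff (Nat.one_le_iff_ne_zero.mp (hpe j).2.2)).mp this)
  have hd : f ∣ minpoly R (Matrix.toLin' c) := (dvd_pow_self f hi0).trans (dvd_minpoly hi.1)
  simp only [Finset.mem_coe, Multiset.mem_toFinset]
  exact (UniqueFactorizationMonoid.mem_normalizedFactors_iff' (minpoly_ne_zero' c)).mpr
    ⟨hf, hm.normalize_eq_self, hd⟩

open scoped Classical in
/-- `P_c(g)` for an irreducible polynomial `g`: it is `P_c(g ^ i)` if some power `g ^ i` belongs to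
`𝓜_c` (there is at most one such `i`), and it is empty otherwise. -/
noncomputable def powerIndicesIrred (c : Matrix (Fin n) (Fin n) R) (g : R[X]) : Finset ℕ :=
  if h : ∃ i, g ^ i ∈ maxElementaryDivisors c then powerIndices c (g ^ h.choose) else ∅

/-- The relation `f ∼ g :⇔ R[x]/(f) ≃ R[x]/(g)` as `R`-algebras, on `𝓘_c`. -/
def irredSetoid (c : Matrix (Fin n) (Fin n) R) : Setoid (irredSet c) where
  r f g := Nonempty ((R[X] ⧸ Ideal.span {f.1}) ≃ₐ[R] (R[X] ⧸ Ideal.span {g.1}))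
  iseqv := ⟨fun _ => ⟨AlgEquiv.refl⟩, fun ⟨e⟩ => ⟨e.symm⟩, fun ⟨e⟩ ⟨f⟩ => ⟨e.trans f⟩⟩

/-- The (finite) set of equivalence classes `𝓘_{c,1}, …, 𝓘_{c,r_c}`. -/
def IrredClass (c : Matrix (Fin n) (Fin n) R) : Type u := Quotient (irredSetoid c)

/-- The representative `p_{c,i}` of the equivalence class `i`. -/
noncomputable def IrredClass.rep {c : Matrix (Fin n) (Fin n) R} (i : IrredClass c) : R[X] :=
  (Quotient.out (s := irredSetoid c) i).1

open scoped Classical in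
/-- The multiset `𝓓_{c,i}`: the multiset union, with multiplicities added up, of all `𝓓_{P_c(f)}`
with `f` in the equivalence class `i`. -/
noncomputable def IrredClass.gaps {c : Matrix (Fin n) (Fin n) R} (i : IrredClass c) :
    Multiset ℕ :=
  haveI : Fintype (irredSet c) := (finite_irredSet c).fintype
  ∑ f : irredSet c with Quotient.mk (irredSetoid c) f = i,
    nontrivialGaps (powerIndicesIrred c f.1)

/-- `c` and `d` are `Sg`-equivalent: there is a bijection `σ` between the equivalence classes (so
`r_c = r_d`) such that `Q_{c,i} ≃ Q_{d,σ(i)}` as `R`-algebras, where `Q_{c,i} = R[x]/(p_{c,i})`, and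
`𝓓_{c,i} = 𝓓_{d,σ(i)}` for all `i`. -/
def SgEquivalent (c : Matrix (Fin n) (Fin n) R) (d : Matrix (Fin m) (Fin m) R) : Prop :=
  ∃ σ : IrredClass c ≃ IrredClass d, ∀ i,
    Nonempty ((R[X] ⧸ Ideal.span {i.rep}) ≃ₐ[R] (R[X] ⧸ Ideal.span {(σ i).rep})) ∧
    i.gaps = (σ i).gaps

end Matrices

end CentralizerMatrix

/-!
The `R[X]`-module `M = Rⁿ` defined by `c` is a finitely generated torsion module, and the centralizer
algebra of `c` is its full endomorphism ring (`isFullEnd_centralizerAlgebra`).  For an irreducible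
polynomial `p` let `P(p)` be the set of exponents `i ≥ 1` such that `p ^ i` is an elementary divisor
of `M`.  Both parts of the statement are read off from these sets, for any ring `A` acting as the
full endomorphism ring of a finitely generated torsion module `M` over a principal ideal domain.

*Cartan determinant.*  The indecomposable projective modules are the `A`-submodules
`{m ∈ M | p ^ i • m = 0}` with `i ∈ P(p)`, and each of them has a unique maximal submodule.  A
generator `y` of a summand `D ⧸ (p ^ i)` spans the image of a primitive idempotent of `A`, and
counting the `t < i` with `p ^ t • y ∈ X` gives the multiplicity of the corresponding simple module
in an `A`-submodule `X` of `M` (`compMultiplicity_eq_card`).  Hence the Cartan matrix is block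
diagonal with the blocks `(min i j)` for `i, j ∈ P(p)`, whose determinants are the products of the
gaps of `P(p)` (`det_min_eq_prod_gaps`).  Gaps equal to `1` do not contribute, so the Cartan
determinant is the product of the multisets attached to the classes of irreducible polynomials
(`cartanDet_eq_finprod`), an invariant of `Sg`-equivalence.

*Quasi-heredity.*  The algebra is quasi-hereditary if and only if every `P(p)` is an initial segment
`{1, …, s}`, that is, if and only if there are no classes of irreducible polynomials at all
(`isQuasiHereditary_iff_irredSet_eq_empty`).  If `P(p)` contains `1`, then the endomorphisms that
vanish on `p • M` form a heredity ideal with quotient `End (p • M)`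
(`isHeredityIdeal_vanishingIdeal`, `exists_isFullEnd_quotient`), and this can be iterated if there
are no gaps (`IsFullEnd.isQuasiHereditary`).  If `l + 1` is missing from `P(p)`, then every member of
a heredity chain vanishes on the `p`-primary part of `p ^ l • M`, which therefore is zero
(`IsFullEnd.exists_isLevelGenerator_of_isQuasiHereditary`).
-/

namespace CentralizerMatrix

universe u v

/-! ### Finitely generated torsion modules over a principal ideal domain -/

section Torsion

variable {D : Type*} [CommRing D] {M : Type*} [AddCommGroup M] [Module D M]

/-- `y` generates a direct summand of `M` isomorphic to `D ⧸ (p ^ (k + 1))`, expressed without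
reference to a decomposition: `y` is killed by `p ^ (k + 1)`, and `p ^ k • y` is not divisible by
`p ^ (k + 1)`.  Such a `y` exists if and only if `p ^ (k + 1)` is an elementary divisor of `M`. -/
def IsLevelGenerator (p : D) (k : ℕ) (y : M) : Prop :=
  p ^ (k + 1) • y = 0 ∧ ∀ x : M, p ^ (k + 1) • x ≠ p ^ k • y

theorem IsLevelGenerator.pow_smul_ne_zero {p : D} {k : ℕ} {y : M} (h : IsLevelGenerator p k y) :
    p ^ k • y ≠ 0 := fun h0 => h.2 0 (by rw [smul_zero, h0])

theorem IsLevelGenerator.of_associated {p q : D} (hpq : Associated p q) {k : ℕ} {y : M}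
    (h : IsLevelGenerator p k y) : IsLevelGenerator q k y := by
  obtain ⟨u, rfl⟩ := hpq
  refine ⟨?_, fun x hx => h.2 ((u : D) • x) ?_⟩
  · rw [mul_pow, mul_comm, mul_smul, h.1, smul_zero]
  · have h2 : (u : D) ^ k • (p ^ (k + 1) • (u : D) • x) = (u : D) ^ k • p ^ k • y := by
      rw [← mul_smul, ← mul_smul, ← mul_smul, mul_comm _ (p ^ k), ← mul_pow, ← hx]
      congr 1
      ring
    have h3 := congrArg (fun m => ((u⁻¹ : Dˣ) : D) ^ k • m) h2
    simp only [← mul_smul _ _ (_ : M), ← mul_assoc, ← mul_pow, Units.inv_mul, one_pow, one_mul]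
      at h3
    rw [← mul_smul]
    exact h3

theorem eq_zero_of_coprime_smul {a b : D} (h : IsCoprime a b) {x : M} (ha : a • x = 0)
    (hb : b • x = 0) : x = 0 := by
  obtain ⟨u, v, huv⟩ := h
  rw [← one_smul D x, ← huv, add_smul, mul_smul, mul_smul, ha, hb, smul_zero, smul_zero, add_zero]

variable {ι : Type*} {p : ι → D} {e : ι → ℕ}

section

variable [IsPrincipalIdealRing D]

theorem coprime_pow_of_not_associated {p q : D} (hp : Irreducible p) (hq : Irreducible q)
    (h : ¬ Associated p q) (a b : ℕ) : IsCoprime (p ^ a) (q ^ b) :=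
  IsCoprime.pow ((hp.coprime_iff_not_dvd).mpr fun hd => h (hp.associated_of_dvd hq hd))

end

variable [IsDomain D]

/-- The standard generators of the summands of a decomposition are level generators. -/
theorem isLevelGenerator_single [DecidableEq ι] (φ : M ≃ₗ[D] Π i, D ⧸ Ideal.span {p i ^ e i})
    (hp : ∀ i, Irreducible (p i)) {i : ι} {k : ℕ} (hk : e i = k + 1) :
    IsLevelGenerator (p i) k (φ.symm (Pi.single i 1)) := by
  refine ⟨?_, fun x hx => ?_⟩
  · rw [← map_smul, ← Pi.single_smul, LinearEquiv.map_eq_zero_iff, Pi.single_eq_zero_iff,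
      ← map_one (Ideal.Quotient.mk (Ideal.span {p i ^ e i}))]
    change Ideal.Quotient.mk (Ideal.span {p i ^ e i}) (p i ^ (k + 1) * 1) = 0
    rw [Ideal.Quotient.eq_zero_iff_mem, Ideal.mem_span_singleton, mul_one, hk]
  · have h1 := congrFun (congrArg φ hx) i
    rw [← map_smul, LinearEquiv.apply_symm_apply, map_smul, Pi.smul_apply, Pi.smul_apply,
      Pi.single_eq_same] at h1
    obtain ⟨d, hd⟩ := Ideal.Quotient.mk_surjective (φ x i)
    rw [← hd] at h1
    change Ideal.Quotient.mk (Ideal.span {p i ^ e i}) (p i ^ (k + 1) * d) =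
      Ideal.Quotient.mk (Ideal.span {p i ^ e i}) (p i ^ k * 1) at h1
    rw [Ideal.Quotient.eq, Ideal.mem_span_singleton, hk] at h1
    have h2 : p i ^ (k + 1) ∣ p i ^ k := by
      simpa using (Dvd.intro d rfl : p i ^ (k + 1) ∣ p i ^ (k + 1) * d).sub h1
    have := (pow_dvd_pow_iff (hp i).ne_zero (hp i).not_isUnit).mp h2
    omega

variable [IsPrincipalIdealRing D]

/-- A cyclic module `D ⧸ (q ^ e)` contains a level generator for `p ^ (k + 1)` only if `p` is
associated to `q` and `e = k + 1`, and then every level generator generates. -/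
theorem IsLevelGenerator.cyclic {p q : D} (hp : Irreducible p) (hq : Irreducible q) {k e : ℕ}
    {w : D ⧸ Ideal.span {q ^ e}} (hw : IsLevelGenerator p k w) :
    Associated p q ∧ e = k + 1 ∧ ∃ d : D, d • w = 1 := by
  obtain ⟨d, rfl⟩ := Ideal.Quotient.mk_surjective w
  have hsm : ∀ a b : D, a • (Ideal.Quotient.mk (Ideal.span {q ^ e}) b) =
    Ideal.Quotient.mk (Ideal.span {q ^ e}) (a * b) := fun a b => rfl
  have hzero : ∀ a : D, Ideal.Quotient.mk (Ideal.span {q ^ e}) a = 0 ↔ q ^ e ∣ a := fun a => by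
    rw [Ideal.Quotient.eq_zero_iff_mem, Ideal.mem_span_singleton]
  have hne := hw.pow_smul_ne_zero
  have hass : Associated p q := by
    by_contra hass
    refine hw.pow_smul_ne_zero ?_
    have h1 := hw.1
    rw [hsm, hzero] at h1 ⊢
    exact ((coprime_pow_of_not_associated hp hq hass _ _).symm.dvd_of_dvd_mul_left h1).mul_left _
  have hdv : ∀ a : D, q ^ e ∣ a ↔ p ^ e ∣ a := fun a => (hass.symm.pow_pow).dvd_iff_dvd_left
  have h1 := hw.1
  rw [hsm, hzero, hdv] at h1
  rw [hsm, Ne, hzero, hdv] at hne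
  have hek : k + 1 ≤ e := by
    by_contra hlt
    exact hne ((pow_dvd_pow p (by omega)).mul_right _)
  have hpd : ¬ p ∣ d := by
    rintro ⟨d', rfl⟩
    refine hw.2 (Ideal.Quotient.mk _ d') ?_
    rw [hsm, hsm]
    congr 1
    ring
  have hcop : ∀ n, IsCoprime (p ^ n) d := fun n =>
    IsCoprime.pow_left ((hp.coprime_iff_not_dvd).mpr hpd)
  have hke : e ≤ k + 1 := by
    have := (hcop e).dvd_of_dvd_mul_right h1
    exact (pow_dvd_pow_iff hp.ne_zero hp.not_isUnit).mp this
  refine ⟨hass, le_antisymm hke hek, ?_⟩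
  obtain ⟨u, v, huv⟩ := hcop e
  refine ⟨v, ?_⟩
  rw [hsm, ← (Ideal.Quotient.mk (Ideal.span {q ^ e})).map_one, Ideal.Quotient.eq,
    Ideal.mem_span_singleton, hdv]
  exact ⟨-u, by rw [← huv]; ring⟩

/-- A generator of level `k + 1` at `q` exists only if `D ⧸ (q ^ (k + 1))` is one of the summands of
a given decomposition, and its component in one of these summands generates the summand. -/
theorem IsLevelGenerator.exists_component (φ : M ≃ₗ[D] Π i, D ⧸ Ideal.span {p i ^ e i})
    (hp : ∀ i, Irreducible (p i)) {q : D} (hq : Irreducible q) {k : ℕ} {y : M}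
    (hy : IsLevelGenerator q k y) :
    ∃ i, Associated q (p i) ∧ e i = k + 1 ∧ ∃ d : D, d • φ y i = 1 := by
  have hex : ∃ i, IsLevelGenerator q k (φ y i) := by
    by_contra hcon
    push Not at hcon
    have h1 : ∀ i, ∃ x, q ^ (k + 1) • x = q ^ k • φ y i := by
      intro i
      by_contra hx
      push Not at hx
      exact hcon i ⟨by rw [← Pi.smul_apply, ← map_smul, hy.1, map_zero, Pi.zero_apply], hx⟩
    choose x hx using h1
    refine hy.2 (φ.symm x) (φ.injective ?_)
    rw [map_smul, LinearEquiv.apply_symm_apply, map_smul]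
    ext i
    exact hx i
  obtain ⟨i, hi⟩ := hex
  exact ⟨i, hi.cyclic hq (hp i)⟩

theorem exists_primaryDecomposition [Module.Finite D M] (hM : Module.IsTorsion D M) :
    ∃ (r : ℕ) (p : Fin r → D) (e : Fin r → ℕ), (∀ i, Irreducible (p i) ∧ 1 ≤ e i) ∧
      Nonempty (M ≃ₗ[D] Π i, D ⧸ Ideal.span {p i ^ e i}) := by
  classical
  obtain ⟨ι, _, p, hp, e, ⟨φ⟩⟩ := Module.equiv_directSum_of_isTorsion hM
  let ε := Fintype.equivFin {i : ι // 1 ≤ e i}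
  refine ⟨_, fun j => p (ε.symm j), fun j => e (ε.symm j),
    fun j => ⟨hp _, (ε.symm j).2⟩, ⟨?_⟩⟩
  let ρ : (Π i, D ⧸ Ideal.span {p i ^ e i}) →ₗ[D]
      Π j : {i : ι // 1 ≤ e i}, D ⧸ Ideal.span {p j ^ e j} :=
    LinearMap.pi fun j => LinearMap.proj (j : ι)
  have htriv : ∀ i, ¬ 1 ≤ e i → ∀ x : D ⧸ Ideal.span {p i ^ e i}, x = 0 := by
    intro i hi x
    obtain ⟨d, rfl⟩ := Ideal.Quotient.mk_surjective x
    rw [Ideal.Quotient.eq_zero_iff_mem, Ideal.mem_span_singleton,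
      show e i = 0 by omega, pow_zero]
    exact one_dvd d
  refine ((φ.trans (DirectSum.linearEquivFunOnFintype D ι _)).trans
    (LinearEquiv.ofBijective ρ ⟨?_, ?_⟩)).trans
      (LinearEquiv.piCongrLeft' D (fun j : {i : ι // 1 ≤ e i} => D ⧸ Ideal.span {p j ^ e j}) ε)
  · rw [injective_iff_map_eq_zero]
    intro x hx
    ext i
    by_cases hi : 1 ≤ e i
    · exact congrFun hx ⟨i, hi⟩
    · exact htriv i hi _
  · intro y
    refine ⟨fun i => if hi : 1 ≤ e i then y ⟨i, hi⟩ else 0, ?_⟩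
    ext j
    exact dif_pos j.2

/-- A generator of level `k + 1` at `p` is mapped to `1` by a `D`-linear map `M → D ⧸ (p ^ (k+1))`,
so that it spans a direct summand. -/
theorem IsLevelGenerator.exists_functional [Module.Finite D M] (hM : Module.IsTorsion D M)
    {q : D} (hq : Irreducible q) {k : ℕ} {y : M} (hy : IsLevelGenerator q k y) :
    ∃ l : M →ₗ[D] D ⧸ Ideal.span {q ^ (k + 1)}, l y = 1 := by
  obtain ⟨r, p, e, hpe, ⟨φ⟩⟩ := exists_primaryDecomposition hM
  obtain ⟨i, hass, he, d, hd⟩ := hy.exists_component φ (fun i => (hpe i).1) hq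
  have hspan : Ideal.span {p i ^ e i} = Ideal.span {q ^ (k + 1)} := by
    rw [Ideal.span_singleton_eq_span_singleton, he]
    exact hass.symm.pow_pow
  refine ⟨(d • (Submodule.quotEquivOfEq _ _ hspan).toLinearMap) ∘ₗ LinearMap.proj i ∘ₗ
    φ.toLinearMap, ?_⟩
  change d • Submodule.quotEquivOfEq _ _ hspan (φ y i) = 1
  rw [← map_smul, hd]
  rfl

theorem exists_isLevelGenerator_of_pow_smul [Module.Finite D M] (hM : Module.IsTorsion D M)
    {q : D} (hq : Irreducible q) {a : ℕ} {x : M} (h0 : q ^ a • x ≠ 0) (h1 : q ^ (a + 1) • x = 0) :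
    ∃ k, a ≤ k ∧ ∃ y : M, IsLevelGenerator q k y := by
  obtain ⟨r, p, e, hpe, ⟨φ⟩⟩ := exists_primaryDecomposition hM
  obtain ⟨i, hi⟩ : ∃ i, q ^ a • φ x i ≠ 0 := by
    by_contra hcon
    push Not at hcon
    refine h0 (φ.injective ?_)
    rw [map_smul, map_zero]
    exact funext hcon
  have hi1 : q ^ (a + 1) • φ x i = 0 := by
    rw [← Pi.smul_apply, ← map_smul, h1, map_zero, Pi.zero_apply]
  have hkill : p i ^ e i • φ x i = 0 := by
    obtain ⟨d, hd⟩ := Ideal.Quotient.mk_surjective (φ x i)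
    rw [← hd]
    change Ideal.Quotient.mk (Ideal.span {p i ^ e i}) (p i ^ e i * d) = 0
    rw [Ideal.Quotient.eq_zero_iff_mem, Ideal.mem_span_singleton]
    exact dvd_mul_right _ _
  have hass : Associated q (p i) := by
    by_contra hass
    refine hi ?_
    rw [eq_zero_of_coprime_smul
      (coprime_pow_of_not_associated hq (hpe i).1 hass (a + 1) (e i)) hi1 hkill, smul_zero]
  have hae : a < e i := by
    by_contra hlt
    refine hi ?_
    obtain ⟨c, hc⟩ := (hass.symm.pow_pow (n := e i)).dvd.trans (pow_dvd_pow q (not_lt.mp hlt))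
    rw [hc, mul_comm, mul_smul, hkill, smul_zero]
  exact ⟨e i - 1, by omega, _,
    (isLevelGenerator_single φ (fun i => (hpe i).1) (i := i) (by omega)).of_associated hass.symm⟩

/-- An endomorphism of `f • M` extends to an endomorphism of `M`. -/
theorem exists_extension [Module.Finite D M] (hM : Module.IsTorsion D M) (f : D)
    (ψ : Module.End D (LinearMap.range (LinearMap.lsmul D M f))) :
    ∃ φ : Module.End D M, ∀ x : LinearMap.range (LinearMap.lsmul D M f), φ x = ψ x := by
  classical
  obtain ⟨r, p, e, hpe, ⟨φ⟩⟩ := exists_primaryDecomposition hM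
  have key : ∀ i, ∃ w : M, p i ^ e i • w = 0 ∧
      f • w = ψ ⟨f • φ.symm (Pi.single i 1), ⟨_, rfl⟩⟩ := by
    intro i
    set m := φ.symm (Pi.single i (1 : D ⧸ Ideal.span {p i ^ e i})) with hm
    have hm0 : p i ^ e i • m = 0 := by
      obtain ⟨k, hk⟩ : ∃ k, e i = k + 1 := ⟨e i - 1, by have := (hpe i).2; omega⟩
      rw [hk]
      exact (isLevelGenerator_single φ (fun i => (hpe i).1) hk).1
    obtain ⟨w, hw⟩ := (ψ ⟨f • m, ⟨_, rfl⟩⟩).2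
    change f • w = _ at hw
    -- With `g = gcd (f, p ^ e)`, `f = g f'`, `p ^ e = g a'` and `u f' + v a' = 1`, the element
    -- `u f' w` is killed by `p ^ e` and has the same multiple by `f` as `w`.
    obtain ⟨g, hg⟩ := IsPrincipalIdealRing.principal (Ideal.span {f, p i ^ e i})
    replace hg : Ideal.span {f, p i ^ e i} = Ideal.span {g} := hg
    obtain ⟨f', hf'⟩ : g ∣ f := by
      rw [← Ideal.mem_span_singleton]
      exact hg ▸ Ideal.subset_span (by simp)
    obtain ⟨a', ha'⟩ : g ∣ p i ^ e i := by
      rw [← Ideal.mem_span_singleton]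
      exact hg ▸ Ideal.subset_span (by simp)
    obtain ⟨u, v, huv⟩ := Ideal.mem_span_pair.mp
      (hg ▸ Ideal.mem_span_singleton_self g : g ∈ Ideal.span {f, p i ^ e i})
    have hg0 : g ≠ 0 := by
      rintro rfl
      rw [zero_mul] at ha'
      exact pow_ne_zero _ (hpe i).1.ne_zero ha'
    have huv' : u * f' + v * a' = 1 := by
      refine mul_left_cancel₀ hg0 ?_
      rw [mul_one]
      refine Eq.trans ?_ huv
      rw [ha']
      conv_rhs => rw [hf']
      ring
    have hafw : a' • f • w = 0 := by
      rw [hw, ← Submodule.coe_smul, ← map_smul]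
      have : a' • (⟨f • m, ⟨m, rfl⟩⟩ : LinearMap.range (LinearMap.lsmul D M f)) = 0 := by
        apply Subtype.ext
        change a' • f • m = 0
        rw [hf', ← mul_smul, show a' * (g * f') = f' * (g * a') by ring, ← ha', mul_smul, hm0,
          smul_zero]
      rw [this, map_zero, Submodule.coe_zero]
    refine ⟨(u * f') • w, ?_, ?_⟩
    · rw [ha', ← mul_smul, show g * a' * (u * f') = u * (a' * (g * f')) by ring, ← hf', mul_smul,
        mul_smul, hafw, smul_zero]
    · rw [← hw, ← mul_smul, show f * (u * f') = f * (u * f' + v * a') - v * (a' * f) by ring, huv',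
        mul_one, sub_smul, mul_smul v, mul_smul a', hafw, smul_zero, sub_zero]
  choose w hw0 hw using key
  let χ : ∀ i, (D ⧸ Ideal.span {p i ^ e i}) →ₗ[D] M := fun i =>
    (Ideal.span {p i ^ e i}).liftQ (LinearMap.toSpanSingleton D M (w i)) (by
      rw [Ideal.span, Submodule.span_le, Set.singleton_subset_iff]
      exact hw0 i)
  have hχ : ∀ i, χ i 1 = w i := fun i => by
    change (Ideal.span {p i ^ e i}).liftQ _ _ (Submodule.Quotient.mk 1) = _
    rw [Submodule.liftQ_apply]
    exact one_smul _ _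
  let Φ : Module.End D M := (∑ i, χ i ∘ₗ LinearMap.proj i) ∘ₗ φ.toLinearMap
  have hΦ : ∀ i, Φ (φ.symm (Pi.single i 1)) = w i := by
    intro i
    change (∑ j, χ j ∘ₗ LinearMap.proj j) (φ (φ.symm (Pi.single i 1))) = w i
    rw [LinearEquiv.apply_symm_apply, LinearMap.sum_apply, Finset.sum_eq_single i]
    · simp [hχ]
    · intro j _ hj
      simp [hj]
    · simp
  refine ⟨Φ, ?_⟩
  let m : M →ₗ[D] LinearMap.range (LinearMap.lsmul D M f) :=
    (LinearMap.lsmul D M f).rangeRestrict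
  have hcomp : (f • Φ) ∘ₗ φ.symm.toLinearMap =
      (Submodule.subtype _ ∘ₗ ψ ∘ₗ m) ∘ₗ φ.symm.toLinearMap := by
    refine LinearMap.pi_ext' fun i => ?_
    refine Submodule.linearMap_qext _ (LinearMap.ext_ring ?_)
    change f • Φ (φ.symm (Pi.single i 1)) = _
    rw [hΦ, hw]
    rfl
  rintro ⟨_, x, rfl⟩
  have := LinearMap.congr_fun hcomp (φ x)
  simp only [LinearMap.comp_apply, LinearEquiv.coe_coe, LinearEquiv.symm_apply_apply] at this
  change Φ (f • x) = _
  rw [map_smul]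
  exact this

end Torsion

/-! ### Operators of rank one in an endomorphism ring -/

section FullAction

variable {D : Type*} [CommRing D] {M : Type*} [AddCommGroup M] [Module D M]
variable {A : Type*} [Ring A] [Module A M] [SMulCommClass A D M]

/-- The ring `A` acts on the `D`-module `M` as its full endomorphism ring. -/
def IsFullEnd (A D M : Type*) [CommRing D] [AddCommGroup M] [Module D M] [Ring A] [Module A M]
    [SMulCommClass A D M] : Prop :=
  Function.Bijective (Module.toModuleEnd D (S := A) M)

theorem IsFullEnd.ext (hA : IsFullEnd A D M) {a b : A} (h : ∀ m : M, a • m = b • m) : a = b :=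
  hA.1 (LinearMap.ext h)

theorem IsFullEnd.exists_smul_eq (hA : IsFullEnd A D M) (φ : Module.End D M) :
    ∃ a : A, ∀ m, a • m = φ m := by
  obtain ⟨a, ha⟩ := hA.2 φ
  exact ⟨a, fun m => LinearMap.congr_fun ha m⟩

/-- The `A`-submodule of all elements of `M` killed by `q`. -/
def killedBy (A M : Type*) {D : Type*} [CommRing D] [AddCommGroup M] [Module D M] [Ring A] [Module A M]
    [SMulCommClass A D M] (q : D) : Submodule A M where
  carrier := {m | q • m = 0}
  add_mem' {x y} hx hy := by
    change q • (x + y) = 0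
    rw [smul_add, hx, hy, add_zero]
  zero_mem' := smul_zero q
  smul_mem' a x hx := by
    change q • a • x = 0
    rw [← smul_comm, hx, smul_zero]

theorem mem_killedBy {q : D} {m : M} : m ∈ killedBy A M q ↔ q • m = 0 := Iff.rfl

/-- For a functional `l : M → D ⧸ (q)` and `m ∈ M` with `q • m = 0` there is the operator
`x ↦ l x • m`; it depends `A`-linearly on `m`. -/
theorem IsFullEnd.exists_rankOne (hA : IsFullEnd A D M) {q : D} (l : M →ₗ[D] D ⧸ Ideal.span {q}) :
    ∃ E : killedBy A M q →ₗ[A] A, ∀ (m : killedBy A M q) (x : M) (d : D),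
      l x = Ideal.Quotient.mk _ d → E m • x = d • (m : M) := by
  have key : ∀ m : killedBy A M q, ∃ a : A, ∀ (x : M) (d : D),
      l x = Ideal.Quotient.mk _ d → a • x = d • (m : M) := by
    intro m
    let χ : (D ⧸ Ideal.span {q}) →ₗ[D] M :=
      (Ideal.span {q}).liftQ (LinearMap.toSpanSingleton D M m) (by
        rw [Ideal.span, Submodule.span_le, Set.singleton_subset_iff]
        exact m.2)
    obtain ⟨a, ha⟩ := hA.exists_smul_eq (χ ∘ₗ l)
    refine ⟨a, fun x d h => ?_⟩
    rw [ha, LinearMap.comp_apply, h]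
    exact Submodule.liftQ_apply _ _ _
  choose E hE using key
  have hmk : ∀ x, ∃ d, l x = Ideal.Quotient.mk _ d := fun x =>
    (Ideal.Quotient.mk_surjective (l x)).imp fun _ h => h.symm
  refine ⟨{ toFun := E, map_add' := fun m n => hA.ext fun x => ?_,
            map_smul' := fun a m => hA.ext fun x => ?_ }, hE⟩
  · obtain ⟨d, hd⟩ := hmk x
    rw [add_smul, hE _ x d hd, hE _ x d hd, hE _ x d hd, Submodule.coe_add, smul_add]
  · obtain ⟨d, hd⟩ := hmk x
    rw [RingHom.id_apply, smul_eq_mul, mul_smul, hE _ x d hd, hE _ x d hd, Submodule.coe_smul,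
      smul_comm a d]

/-- A finite dual basis of `M` modulo `p • M`. -/
theorem exists_dualBasis_mod [IsDomain D] [IsPrincipalIdealRing D] [Module.Finite D M] {p : D}
    (hp : Irreducible p) :
    ∃ (r : ℕ) (b : Fin r → M) (β : Fin r → M →ₗ[D] D ⧸ Ideal.span {p}),
      ∀ (x : M) (d : Fin r → D), (∀ i, β i x = Ideal.Quotient.mk _ (d i)) →
        ∃ w : M, x = ∑ i, d i • b i + p • w := by
  have : (Ideal.span {p}).IsMaximal := PrincipalIdealRing.isMaximal_of_irreducible hp
  let _ := Ideal.Quotient.field (Ideal.span {p})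
  let N : Submodule D M := Ideal.span {p} • (⊤ : Submodule D M)
  have : Module.Finite (D ⧸ Ideal.span {p}) (M ⧸ N) :=
    Module.Finite.of_restrictScalars_finite D _ _
  let B := Module.finBasis (D ⧸ Ideal.span {p}) (M ⧸ N)
  choose b hb using fun i => N.mkQ_surjective (B i)
  refine ⟨_, b, fun i => (B.coord i).restrictScalars D ∘ₗ N.mkQ, fun x d hd => ?_⟩
  have h1 : N.mkQ (x - ∑ i, d i • b i) = 0 := by
    rw [map_sub, map_sum, sub_eq_zero, ← B.sum_repr (N.mkQ x)]
    refine Finset.sum_congr rfl fun i _ => ?_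
    rw [map_smul, hb]
    have : B.repr (N.mkQ x) i = Ideal.Quotient.mk _ (d i) := hd i
    rw [this]
    rfl
  rw [Submodule.mkQ_apply, Submodule.Quotient.mk_eq_zero] at h1
  change _ ∈ Ideal.span {p} • (⊤ : Submodule D M) at h1
  rw [Submodule.ideal_span_singleton_smul, Submodule.mem_smul_pointwise_iff_exists] at h1
  obtain ⟨w, -, hw⟩ := h1
  exact ⟨w, by rw [hw, add_sub_cancel]⟩

/-! ### The heredity ideal of endomorphisms that vanish on `p • M` -/

/-- The ideal of all elements of `A` that vanish on `f • M`. -/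
def vanishingIdeal (A M : Type*) {D : Type*} [CommRing D] [AddCommGroup M] [Module D M] [Ring A] [Module A M]
    [SMulCommClass A D M] (f : D) : Ideal A where
  carrier := {a | ∀ m : M, a • f • m = 0}
  add_mem' {a b} ha hb m := by rw [add_smul, ha, hb, add_zero]
  zero_mem' m := zero_smul _ _
  smul_mem' a b hb m := by rw [smul_eq_mul, mul_smul, hb, smul_zero]

theorem mem_vanishingIdeal {f : D} {a : A} :
    a ∈ vanishingIdeal A M f ↔ ∀ m : M, a • f • m = 0 := Iff.rfl

instance (f : D) : (vanishingIdeal A M f).IsTwoSided where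
  mul_mem_of_left b ha m := by rw [mul_smul, smul_comm b, ha]

theorem eq_zero_of_mem_jacobson_of_mul_self {B : Type*} [Ring B] {e : B}
    (he : e ∈ Ring.jacobson B) (h : e * e = e) : e = 0 := by
  rw [← Ideal.jacobson_bot] at he
  obtain ⟨s, hs⟩ := Ideal.exists_mul_add_sub_mem_of_mem_jacobson (-e) (neg_mem he)
  rw [Ideal.mem_bot, sub_eq_zero] at hs
  calc e = s * (-e + 1) * e := by rw [hs, one_mul]
    _ = 0 := by rw [mul_assoc, add_mul, neg_mul, h, one_mul, neg_add_cancel, mul_zero]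

variable [IsDomain D] [IsPrincipalIdealRing D] [Module.Finite D M]

/-- If the simple module `D ⧸ (p)` is a direct summand of `M`, then the endomorphisms of `M` that
vanish on `p • M` form a heredity ideal: they are the endomorphisms that factor through sums of
copies of this summand. -/
theorem isHeredityIdeal_vanishingIdeal (hM : Module.IsTorsion D M) (hA : IsFullEnd A D M) {p : D}
    (hp : Irreducible p) {z : M} (hz : IsLevelGenerator p 0 z) :
    IsHeredityIdeal (vanishingIdeal A M p) := by
  have hfun : ∀ w : M, IsLevelGenerator p 0 w → ∃ l : M →ₗ[D] D ⧸ Ideal.span {p}, l w = 1 := by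
    intro w hw
    have := hw.exists_functional hM hp
    rwa [zero_add, pow_one] at this
  have hkill : ∀ w : M, IsLevelGenerator p 0 w → p • w = 0 := by
    intro w hw
    have := hw.1
    rwa [zero_add, pow_one] at this
  have hzp := hkill z hz
  obtain ⟨l, hl⟩ := hfun z hz
  obtain ⟨E, hE⟩ := hA.exists_rankOne l
  obtain ⟨r, b, β, hβ⟩ := exists_dualBasis_mod (M := M) hp
  choose F hF using fun i => hA.exists_rankOne (β i)
  have hmk : ∀ (l : M →ₗ[D] D ⧸ Ideal.span {p}) x, ∃ d, l x = Ideal.Quotient.mk _ d := fun l x =>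
    (Ideal.Quotient.mk_surjective (l x)).imp fun _ h => h.symm
  -- every operator of rank one vanishes on `p • M`
  have hvan : ∀ (l : M →ₗ[D] D ⧸ Ideal.span {p}) (G : killedBy A M p →ₗ[A] A),
      (∀ (m : killedBy A M p) (x : M) (d : D),
        l x = Ideal.Quotient.mk _ d → G m • x = d • (m : M)) →
      ∀ m, G m ∈ vanishingIdeal A M p := by
    intro l G hG m x
    rw [hG m (p • x) 0, zero_smul]
    obtain ⟨d, hd⟩ := hmk l x
    rw [map_smul, hd, map_zero]
    change Ideal.Quotient.mk _ (p * d) = 0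
    rw [Ideal.Quotient.eq_zero_iff_mem, Ideal.mem_span_singleton]
    exact dvd_mul_right _ _
  have hb : ∀ (a : vanishingIdeal A M p) (i : Fin r), (a : A) • b i ∈ killedBy A M p := by
    intro a i
    rw [mem_killedBy, ← smul_comm]
    exact a.2 _
  let z' : killedBy A M p := ⟨z, hzp⟩
  -- the factorization of an element of the ideal through copies of the summand spanned by `z`
  have hfac : ∀ a : vanishingIdeal A M p, (a : A) = ∑ i, E ⟨(a : A) • b i, hb a i⟩ * F i z' := by
    intro a
    refine hA.ext fun x => ?_
    choose d hd using fun i => hmk (β i) x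
    obtain ⟨w, hw⟩ := hβ x d hd
    rw [Finset.sum_smul]
    have : ∀ i, (E ⟨(a : A) • b i, hb a i⟩ * F i z') • x = d i • (a : A) • b i := by
      intro i
      rw [mul_smul, hF i z' x (d i) (hd i), hE _ _ (d i)]
      rw [map_smul, hl]
      change Ideal.Quotient.mk _ (d i * 1) = _
      rw [mul_one]
    simp_rw [this]
    conv_lhs => rw [hw]
    rw [smul_add, a.2, add_zero, Finset.smul_sum]
    exact Finset.sum_congr rfl fun i _ => smul_comm _ _ _
  refine ⟨inferInstance, le_antisymm Ideal.mul_le_left ?_, ?_, ?_⟩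
  · intro a ha
    rw [show a = _ from hfac ⟨a, ha⟩]
    exact Ideal.sum_mem _ fun i _ => Ideal.mul_mem_mul (hvan l E hE _) (hvan _ _ (hF i) _)
  · rw [eq_bot_iff, Ideal.mul_le]
    intro c hc b' hb'
    revert c
    suffices h : vanishingIdeal A M p * Ring.jacobson A ≤
        { carrier := {c | c * b' = 0}
          add_mem' := fun {x y} hx hy => by
            change (x + y) * b' = 0
            rw [add_mul, hx, hy, add_zero]
          zero_mem' := zero_mul _
          smul_mem' := fun x y hy => by
            change x * y * b' = 0
            rw [mul_assoc, hy, mul_zero] } by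
      exact fun c hc => (Submodule.mem_bot A).mpr (h hc)
    rw [Ideal.mul_le]
    intro a ha e he
    change a * e * b' = 0
    refine hA.ext fun x => ?_
    rw [zero_smul, mul_smul, mul_smul]
    by_contra hne
    have hy : p • b' • x = 0 := by rw [← smul_comm, hb' x]
    -- otherwise `e • b' • x` spans a direct summand, and the projection onto it is in the radical
    have hw : IsLevelGenerator p 0 (e • b' • x) := by
      refine ⟨?_, fun v hv => hne ?_⟩
      · rw [zero_add, pow_one, ← smul_comm, hy, smul_zero]
      · rw [zero_add, pow_one, pow_zero, one_smul] at hv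
        rw [← hv]
        exact ha v
    obtain ⟨l', hl'⟩ := hfun _ hw
    obtain ⟨G, hG⟩ := hA.exists_rankOne l'
    have hGe : e * G ⟨b' • x, hy⟩ = G ⟨e • b' • x, hkill _ hw⟩ := by
      rw [← smul_eq_mul, ← map_smul]
      rfl
    have hGw : G ⟨e • b' • x, hkill _ hw⟩ • e • b' • x = e • b' • x := by
      rw [hG _ _ 1 (by rw [hl', map_one]), one_smul]
    have hidem : G ⟨e • b' • x, hkill _ hw⟩ * G ⟨e • b' • x, hkill _ hw⟩ =
        G ⟨e • b' • x, hkill _ hw⟩ := by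
      rw [← smul_eq_mul, ← map_smul]
      congr 1
      exact Subtype.ext hGw
    have hmem : G ⟨e • b' • x, hkill _ hw⟩ ∈ Ring.jacobson A :=
      hGe ▸ Ideal.mul_mem_right _ _ he
    have h0 := eq_zero_of_mem_jacobson_of_mul_self hmem hidem
    rw [h0, zero_smul] at hGw
    rw [← hGw, smul_zero] at hne
    exact hne rfl
  · refine Module.Projective.of_split (M := Fin r → A)
      (LinearMap.pi fun i =>
        { toFun := fun a => E ⟨(a : A) • b i, hb a i⟩
          map_add' := fun a a' => by
            rw [← map_add]
            congr 1
            exact Subtype.ext (add_smul _ _ _)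
          map_smul' := fun c a => by
            rw [RingHom.id_apply, ← map_smul]
            congr 1
            exact Subtype.ext (mul_smul _ _ _) })
      (∑ i, (LinearMap.toSpanSingleton A (vanishingIdeal A M p)
        ⟨F i z', hvan _ _ (hF i) _⟩) ∘ₗ LinearMap.proj i) ?_
    ext a
    simp only [LinearMap.comp_apply, LinearMap.sum_apply, LinearMap.id_apply,
      Submodule.coe_sum]
    exact (hfac a).symm

end FullAction

/-! ### Quasi-hereditary endomorphism rings -/

section QuasiHereditaryCriterion

theorem mem_jacobson_of_central_of_pow_eq_zero {B : Type*} [Ring B] {c : B}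
    (hc : ∀ b, Commute b c) {n : ℕ} (hn : c ^ n = 0) : c ∈ Ring.jacobson B := by
  rw [← Ideal.jacobson_bot, Ideal.mem_jacobson_iff]
  intro y
  have hnil : IsNilpotent (y * c) := ⟨n, by rw [(hc y).mul_pow, hn, mul_zero]⟩
  obtain ⟨u, hu⟩ := hnil.isUnit_one_add
  refine ⟨(u⁻¹ : Bˣ), ?_⟩
  rw [Ideal.mem_bot, mul_assoc]
  have : (↑u⁻¹ : B) * (1 + y * c) = 1 := by rw [← hu, Units.inv_mul]
  rw [mul_add, mul_one] at this
  rw [← this]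
  abel

/-- If `J` is idempotent modulo `J₀ ≤ I` and `J * J ≤ I`, then `J ≤ I`. -/
theorem le_of_idempotent_mod {A : Type*} [Ring A] {J₀ J I : Ideal A} [J₀.IsTwoSided]
    (hJ : J.map (Ideal.Quotient.mk J₀) * J.map (Ideal.Quotient.mk J₀) =
      J.map (Ideal.Quotient.mk J₀)) (hI : J₀ ≤ I) (h : ∀ a ∈ J, ∀ b ∈ J, a * b ∈ I) : J ≤ I := by
  intro a ha
  have hsurj := Ideal.Quotient.mk_surjective (I := J₀)
  have hle : J.map (Ideal.Quotient.mk J₀) ≤ I.map (Ideal.Quotient.mk J₀) := by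
    rw [← hJ, Ideal.mul_le]
    intro x hx y hy
    obtain ⟨x', hx', rfl⟩ := (Ideal.mem_map_iff_of_surjective _ hsurj).mp hx
    obtain ⟨y', hy', rfl⟩ := (Ideal.mem_map_iff_of_surjective _ hsurj).mp hy
    rw [← map_mul]
    exact Ideal.mem_map_of_mem _ (h x' hx' y' hy')
  obtain ⟨b, hb, hab⟩ := (Ideal.mem_map_iff_of_surjective _ hsurj).mp
    (hle (Ideal.mem_map_of_mem _ ha))
  rw [Ideal.Quotient.eq] at hab
  have := I.sub_mem hb (hI hab)
  rwa [sub_sub_cancel] at this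

variable {D : Type*} [CommRing D] {M : Type*} [AddCommGroup M] [Module D M]
variable {A : Type*} [Ring A] [Module A M] [SMulCommClass A D M]
variable [IsDomain D] [IsPrincipalIdealRing D] [Module.Finite D M]

variable (M) in
/-- A generator of the annihilator of `M`, as a product of irreducible elements. -/
theorem exists_irreducible_list (hM : Module.IsTorsion D M) :
    ∃ l : List D, (∀ p ∈ l, Irreducible p) ∧ (∀ m : M, l.prod • m = 0) ∧
      ∀ c : D, (∀ m : M, c • m = 0) → l.prod ∣ c := by
  obtain ⟨a, ha⟩ := IsPrincipalIdealRing.principal (Module.annihilator D M)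
  replace ha : Module.annihilator D M = Ideal.span {a} := ha
  have ha0 : a ≠ 0 := by
    rintro rfl
    obtain ⟨b, hb, hb0⟩ := Set.nonempty_def.mp
      (Submodule.annihilator_top_inter_nonZeroDivisors hM)
    rw [Submodule.annihilator_top, ha] at hb
    have : b = 0 := by simpa using hb
    exact nonZeroDivisors.ne_zero hb0 this
  obtain ⟨s, hs, hsa⟩ := UniqueFactorizationMonoid.exists_prime_factors a ha0
  refine ⟨s.toList, fun p hp => (hs p (Multiset.mem_toList.mp hp)).irreducible, ?_, ?_⟩
  · intro m
    rw [Multiset.prod_toList]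
    have : s.prod ∈ Module.annihilator D M := by
      rw [ha, Ideal.mem_span_singleton]
      exact hsa.symm.dvd
    exact Module.mem_annihilator.mp this m
  · intro c hc
    rw [Multiset.prod_toList]
    have : c ∈ Module.annihilator D M := Module.mem_annihilator.mpr hc
    rw [ha, Ideal.mem_span_singleton] at this
    exact hsa.dvd.trans this

/-- The quotient of `A` by the endomorphisms vanishing on `f • M` is the full endomorphism ring of
`f • M`. -/
theorem exists_isFullEnd_quotient (hM : Module.IsTorsion D M) (hA : IsFullEnd A D M) (f : D) :
    ∃ (_ : Module (A ⧸ vanishingIdeal A M f) (LinearMap.range (LinearMap.lsmul D M f)))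
      (_ : SMulCommClass (A ⧸ vanishingIdeal A M f) D (LinearMap.range (LinearMap.lsmul D M f))),
      IsFullEnd (A ⧸ vanishingIdeal A M f) D (LinearMap.range (LinearMap.lsmul D M f)) ∧
      ∀ (a : A) (m : LinearMap.range (LinearMap.lsmul D M f)),
        ((Ideal.Quotient.mk (vanishingIdeal A M f) a • m :
          LinearMap.range (LinearMap.lsmul D M f)) : M) = a • (m : M) := by
  have hstab : ∀ (a : A), ∀ m ∈ LinearMap.range (LinearMap.lsmul D M f),
      Module.toModuleEnd D M a m ∈ LinearMap.range (LinearMap.lsmul D M f) := by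
    rintro a _ ⟨x, rfl⟩
    exact ⟨a • x, (smul_comm a f x).symm⟩
  let ρ : A →+* Module.End D (LinearMap.range (LinearMap.lsmul D M f)) :=
    { toFun := fun a => (Module.toModuleEnd D M a).restrict (hstab a)
      map_one' := LinearMap.ext fun m => Subtype.ext (one_smul A (m : M))
      map_mul' := fun a b => LinearMap.ext fun m => Subtype.ext (mul_smul a b (m : M))
      map_zero' := LinearMap.ext fun m => Subtype.ext (zero_smul A (m : M))
      map_add' := fun a b => LinearMap.ext fun m => Subtype.ext (add_smul a b (m : M)) }
  have hρ : ∀ a ∈ vanishingIdeal A M f, ρ a = 0 := by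
    intro a ha
    ext ⟨_, x, rfl⟩
    exact ha x
  have hρ' : ∀ a, ρ a = 0 → a ∈ vanishingIdeal A M f := by
    intro a ha m
    exact congrArg Subtype.val (LinearMap.congr_fun ha ⟨f • m, m, rfl⟩)
  let ρ' := Ideal.Quotient.lift (vanishingIdeal A M f) ρ hρ
  let i1 : Module (A ⧸ vanishingIdeal A M f) (LinearMap.range (LinearMap.lsmul D M f)) :=
    Module.compHom _ ρ'
  let i2 : SMulCommClass (A ⧸ vanishingIdeal A M f) D (LinearMap.range (LinearMap.lsmul D M f)) :=
    ⟨fun a d m => (ρ' a).map_smul d m⟩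
  refine ⟨i1, i2, ⟨?_, ?_⟩, fun a m => rfl⟩
  · rw [injective_iff_map_eq_zero]
    intro a ha
    obtain ⟨a, rfl⟩ := Ideal.Quotient.mk_surjective a
    rw [Ideal.Quotient.eq_zero_iff_mem]
    exact hρ' a ha
  · intro ψ
    obtain ⟨φ, hφ⟩ := exists_extension hM f ψ
    obtain ⟨a, ha⟩ := hA.exists_smul_eq φ
    refine ⟨Ideal.Quotient.mk _ a, ?_⟩
    ext m
    exact (ha m).trans (hφ m)

theorem isHeredityIdeal_map_vanishingIdeal (hM : Module.IsTorsion D M) (hA : IsFullEnd A D M)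
    {p f : D} (hp : Irreducible p) {z : LinearMap.range (LinearMap.lsmul D M f)}
    (hz : IsLevelGenerator p 0 z) :
    IsHeredityIdeal ((vanishingIdeal A M (f * p)).map
      (Ideal.Quotient.mk (vanishingIdeal A M f))) := by
  obtain ⟨i1, i2, hfull, hsm⟩ := exists_isFullEnd_quotient hM hA f
  have hle : vanishingIdeal A M f ≤ vanishingIdeal A M (f * p) := fun a ha m => by
    rw [mul_smul, ha]
  have htors : Module.IsTorsion D (LinearMap.range (LinearMap.lsmul D M f)) := by
    intro x
    obtain ⟨a, ha⟩ := @hM (x : M)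
    exact ⟨a, Subtype.ext ha⟩
  convert isHeredityIdeal_vanishingIdeal htors hfull hp hz using 1
  ext a
  obtain ⟨a, rfl⟩ := Ideal.Quotient.mk_surjective a
  rw [Ideal.mem_map_iff_of_surjective _ Ideal.Quotient.mk_surjective, mem_vanishingIdeal]
  constructor
  · rintro ⟨b, hb, hba⟩ ⟨_, x, rfl⟩
    rw [← hba]
    apply Subtype.ext
    rw [hsm]
    change b • p • f • x = 0
    rw [← mul_smul, mul_comm]
    exact hb x
  · intro h
    refine ⟨a, fun m => ?_, rfl⟩
    have := congrArg Subtype.val (h ⟨f • m, m, rfl⟩)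
    rw [hsm] at this
    change a • p • f • m = 0 at this
    rwa [← mul_smul, mul_comm] at this

/-- If with every elementary divisor `p ^ i` all `p ^ j` with `1 ≤ j ≤ i` are elementary divisors,
then the endomorphisms vanishing on `f • M`, with `f` running through the initial products of a
factorization of the annihilator of `M` into irreducibles, form a heredity chain. -/
theorem IsFullEnd.isQuasiHereditary (hM : Module.IsTorsion D M) (hA : IsFullEnd A D M)
    (hlev : ∀ p : D, Irreducible p → ∀ k l, l ≤ k → (∃ y : M, IsLevelGenerator p k y) →
      ∃ y : M, IsLevelGenerator p l y) : IsQuasiHereditary A := by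
  obtain ⟨l, hirr, hkill, hmin⟩ := exists_irreducible_list M hM
  have key : ∀ f p r : D, Irreducible p → l.prod = f * p * r →
      vanishingIdeal A M f ≤ vanishingIdeal A M (f * p) ∧
        IsHeredityIdeal ((vanishingIdeal A M (f * p)).map
          (Ideal.Quotient.mk (vanishingIdeal A M f))) := by
    intro f p r hp hprod
    have hl0 : l.prod ≠ 0 := List.prod_ne_zero fun h0 => (hirr 0 h0).ne_zero rfl
    have hf0 : f ≠ 0 := by
      rintro rfl
      exact hl0 (by rw [hprod, zero_mul, zero_mul])
    have hr0 : r ≠ 0 := by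
      rintro rfl
      exact hl0 (by rw [hprod, mul_zero])
    refine ⟨fun a ha m => by rw [mul_smul, ha], ?_⟩
    obtain ⟨x, hx⟩ : ∃ x : M, (f * r) • x ≠ 0 := by
      by_contra hcon
      push Not at hcon
      have h1 := hmin _ hcon
      rw [hprod, show f * p * r = p * (f * r) by ring] at h1
      have h2 : p * (f * r) ∣ 1 * (f * r) := by rwa [one_mul]
      exact hp.not_isUnit
        (isUnit_of_dvd_one ((mul_dvd_mul_iff_right (mul_ne_zero hf0 hr0)).mp h2))
    -- the element `t * r • x` shows that some `p ^ i` with `i > α` is an elementary divisor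
    obtain ⟨t, hft, hpt⟩ :=
      (FiniteMultiplicity.of_not_isUnit hp.not_isUnit hf0).exists_eq_pow_mul_and_not_dvd
    generalize multiplicity p f = α at hft
    subst hft
    obtain ⟨k, hk, hky⟩ := exists_isLevelGenerator_of_pow_smul hM hp (a := α) (x := (t * r) • x)
      (by rwa [← mul_smul, ← mul_assoc]) (by
        rw [← mul_smul, show p ^ (α + 1) * (t * r) = p ^ α * t * p * r by ring, ← hprod, hkill])
    obtain ⟨y, hy⟩ := hlev p hp k α hk hky
    refine isHeredityIdeal_map_vanishingIdeal hM hA hp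
      (z := ⟨(p ^ α * t) • y, y, rfl⟩) ⟨?_, ?_⟩
    · apply Subtype.ext
      change p ^ (0 + 1) • (p ^ α * t) • y = 0
      rw [← mul_smul, show p ^ (0 + 1) * (p ^ α * t) = t * p ^ (α + 1) by ring, mul_smul, hy.1,
        smul_zero]
    · rintro ⟨_, w, rfl⟩ hw
      have hw' : p ^ (0 + 1) • (p ^ α * t) • w = p ^ 0 • (p ^ α * t) • y :=
        congrArg Subtype.val hw
      obtain ⟨u, v, huv⟩ := (hp.coprime_iff_not_dvd).mpr hpt
      refine hy.2 (u • y + (v * t) • w) ?_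
      have : p ^ α • y = (u * p + v * t) • p ^ α • y := by rw [huv, one_smul]
      rw [this, add_smul, smul_add, ← mul_smul, ← mul_smul, ← mul_smul, ← mul_smul]
      congr 1
      · congr 1
        ring
      · rw [show p ^ (α + 1) * (v * t) = v * (p ^ (0 + 1) * (p ^ α * t)) by ring, mul_smul v,
          mul_smul (p ^ (0 + 1)), hw', pow_zero, one_smul, ← mul_smul]
        congr 1
        ring
  refine ⟨l.length, fun i => vanishingIdeal A M (l.take i).prod, fun i => inferInstance, ?_, ?_, ?_⟩
  · rw [eq_bot_iff]
    intro a ha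
    refine (Submodule.mem_bot A).mpr (hA.ext (M := M) (D := D) fun m => ?_)
    have := ha m
    rwa [List.take_zero, List.prod_nil, one_smul, ← zero_smul A m] at this
  · rw [Ideal.eq_top_iff_one]
    intro m
    rw [List.take_length, hkill, smul_zero]
  · intro i hi
    have hsucc : (l.take (i + 1)).prod = (l.take i).prod * l[i] := by
      rw [List.take_add_one, List.prod_append, List.getElem?_eq_getElem hi]
      simp
    have hp : Irreducible l[i] := hirr _ (List.getElem_mem hi)
    have hprod : l.prod = (l.take i).prod * l[i] * (l.drop (i + 1)).prod := by
      rw [← hsucc, List.prod_take_mul_prod_drop]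
    have hstep := key _ _ _ hp hprod
    rw [← hsucc] at hstep
    exact hstep

/-- Over a quasi-hereditary endomorphism ring the elementary divisors of `M` have no gaps.  If
`p ^ (l + 1)` is not an elementary divisor, then in the `p`-primary part `L` of `p ^ l • M` the
elements killed by `p` lie in `p • L`.  An idempotent ideal `J` with `J * rad A * J = 0` on `L`
then vanishes on `L`, since a multiple of `p` that is a unit times `p` on `L` is central and
nilpotent; so no heredity chain can reach `A` unless `L = 0`. -/
theorem IsFullEnd.exists_isLevelGenerator_of_isQuasiHereditary (hM : Module.IsTorsion D M)
    (hA : IsFullEnd A D M) (hQ : IsQuasiHereditary A) {p : D} (hp : Irreducible p) {k l : ℕ}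
    (hlk : l ≤ k) {y : M} (hy : IsLevelGenerator p k y) : ∃ y : M, IsLevelGenerator p l y := by
  by_contra hno
  push Not at hno
  let L : Set M := {x | (∃ w, x = p ^ l • w) ∧ ∃ N : ℕ, p ^ N • x = 0}
  have hLA : ∀ (a : A), ∀ x ∈ L, a • x ∈ L := by
    rintro a x ⟨⟨w, rfl⟩, N, hN⟩
    exact ⟨⟨a • w, smul_comm _ _ _⟩, N, by rw [← smul_comm a, hN, smul_zero]⟩
  have hsoc : ∀ x ∈ L, p • x = 0 → ∃ x' ∈ L, x = p • x' := by
    rintro x ⟨⟨w, rfl⟩, -⟩ hx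
    have h1 : p ^ (l + 1) • w = 0 := by rw [pow_succ', mul_smul, hx]
    have h2 := hno w
    unfold IsLevelGenerator at h2
    push Not at h2
    obtain ⟨v, hv⟩ := h2 h1
    refine ⟨p ^ l • v, ⟨⟨v, rfl⟩, 2, ?_⟩, ?_⟩
    · rw [← mul_smul, show p ^ 2 * p ^ l = p * p ^ (l + 1) by ring, mul_smul, hv, hx]
    · rw [← hv, pow_succ', mul_smul]
  -- `a = p ^ α * t` annihilates `M`, and `p * t` acts as a central nilpotent element of `A`
  obtain ⟨s, hirr, hkill, -⟩ := exists_irreducible_list M hM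
  have ha0 : s.prod ≠ 0 := List.prod_ne_zero fun h0 => (hirr 0 h0).ne_zero rfl
  obtain ⟨t, hat, hpt⟩ :=
    (FiniteMultiplicity.of_not_isUnit hp.not_isUnit ha0).exists_eq_pow_mul_and_not_dvd
  generalize multiplicity p s.prod = α at hat
  rw [hat] at hkill
  obtain ⟨c, hc⟩ := hA.exists_smul_eq (LinearMap.lsmul D M (p * t))
  replace hc : ∀ m : M, c • m = (p * t) • m := hc
  have hcent : ∀ b, Commute b c := fun b => hA.ext fun m => by
    rw [mul_smul, mul_smul, hc, hc, smul_comm]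
  have hpow : ∀ (n : ℕ) (m : M), c ^ n • m = (p * t) ^ n • m := by
    intro n
    induction n with
    | zero => intro m; simp
    | succ n ih => intro m; rw [pow_succ, mul_smul, hc, ih, ← mul_smul, ← pow_succ]
  have hnil : c ^ (α + 1) = 0 := hA.ext fun m => by
    rw [hpow, show (p * t) ^ (α + 1) = p * t ^ α * (p ^ α * t) by ring, mul_smul, hkill,
      smul_zero, zero_smul]
  have hcL : ∀ x ∈ L, c • x = 0 → p • x = 0 := by
    rintro x ⟨-, N, hN⟩ hx
    rw [hc] at hx
    refine eq_zero_of_coprime_smul (a := p ^ N) (b := t)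
      (IsCoprime.pow_left ((hp.coprime_iff_not_dvd).mpr hpt)) ?_ ?_
    · rw [smul_comm, hN, smul_zero]
    · rw [← mul_smul, mul_comm, hx]
  obtain ⟨n, J, hJ2, hJ0, hJn, hJ⟩ := hQ
  let I₀ : Ideal A :=
    { carrier := {a | ∀ x ∈ L, a • x = 0}
      add_mem' := fun {a b} ha hb x hx => by rw [add_smul, ha x hx, hb x hx, add_zero]
      zero_mem' := fun x _ => zero_smul A x
      smul_mem' := fun a b hb x hx => by rw [smul_eq_mul, mul_smul, hb x hx, smul_zero] }
  let I₁ : Ideal A :=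
    { carrier := {a | ∀ x ∈ L, p • a • x = 0}
      add_mem' := fun {a b} ha hb x hx => by rw [add_smul, smul_add, ha x hx, hb x hx, add_zero]
      zero_mem' := fun x _ => by rw [zero_smul, smul_zero]
      smul_mem' := fun a b hb x hx => by
        rw [smul_eq_mul, mul_smul, ← smul_comm a, hb x hx, smul_zero] }
  have h01 : I₀ ≤ I₁ := fun a ha x hx => by rw [ha x hx, smul_zero]
  have hind : ∀ i ≤ n, J i ≤ I₀ := by
    intro i
    induction i with
    | zero => intro _; rw [hJ0]; exact bot_le
    | succ i ih =>
      intro hi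
      have hi0 := ih (by omega)
      obtain ⟨-, -, hidem, hrad, -⟩ := hJ i (by omega)
      have h1 : J (i + 1) ≤ I₁ := by
        refine le_of_idempotent_mod hidem (hi0.trans h01) fun a ha b hb x hx => ?_
        rw [mul_smul]
        refine hcL _ (hLA _ _ (hLA _ _ hx)) ?_
        have hmem : Ideal.Quotient.mk (J i) (a * c * b) = 0 := by
          rw [map_mul, map_mul, ← Submodule.mem_bot (A ⧸ J i), ← hrad]
          refine Ideal.mul_mem_mul (Ideal.mul_mem_mul (Ideal.mem_map_of_mem _ ha)
            (mem_jacobson_of_central_of_pow_eq_zero (n := α + 1) (fun b => ?_) ?_))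
            (Ideal.mem_map_of_mem _ hb)
          · obtain ⟨b, rfl⟩ := Ideal.Quotient.mk_surjective b
            exact (hcent b).map _
          · rw [← map_pow, hnil, map_zero]
        rw [Ideal.Quotient.eq_zero_iff_mem, (hcent a).eq] at hmem
        have := hi0 hmem x hx
        rwa [mul_smul, mul_smul] at this
      refine le_of_idempotent_mod hidem hi0 fun a ha b hb x hx => ?_
      obtain ⟨x', hx', hbx⟩ := hsoc _ (hLA b x hx) (h1 hb x hx)
      rw [mul_smul, hbx, smul_comm]
      exact h1 ha x' hx'
  have hone : (1 : A) ∈ I₀ := hind n le_rfl (hJn ▸ Submodule.mem_top)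
  have hyL : p ^ l • y ∈ L := by
    refine ⟨⟨y, rfl⟩, k + 1, ?_⟩
    rw [smul_comm, hy.1, smul_zero]
  have hy0 : p ^ l • y = 0 := by
    rw [← one_smul A (p ^ l • y)]
    exact hone _ hyL
  refine hy.pow_smul_ne_zero ?_
  rw [← Nat.sub_add_cancel hlk, pow_add, mul_smul, hy0, smul_zero]

end QuasiHereditaryCriterion

/-! ### Projective covers and Cartan matrices -/

section ProjectiveCovers

variable {A : Type u} [Ring A]

/-- Projective covers of isomorphic modules are isomorphic. -/
theorem nonempty_equiv_of_isProjectiveCover {P P' S S' : Type u}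
    [AddCommGroup P] [Module A P] [AddCommGroup P'] [Module A P'] [AddCommGroup S] [Module A S]
    [AddCommGroup S'] [Module A S'] {π : P →ₗ[A] S} {π' : P' →ₗ[A] S'}
    (h : IsProjectiveCover π) (h' : IsProjectiveCover π') (e : S ≃ₗ[A] S') :
    Nonempty (P ≃ₗ[A] P') := by
  obtain ⟨hP, hπ, hsup⟩ := h
  obtain ⟨hP', hπ', hsup'⟩ := h'
  obtain ⟨f, hf⟩ := Module.projective_lifting_property π' (e.toLinearMap ∘ₗ π) hπ'
  have hf' : ∀ x, π' (f x) = e (π x) := fun x => LinearMap.congr_fun hf x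
  have hfs : Function.Surjective f := by
    rw [← LinearMap.range_eq_top]
    refine hsup' _ (eq_top_iff.mpr fun x _ => ?_)
    obtain ⟨z, hz⟩ := hπ (e.symm (π' x))
    refine Submodule.mem_sup.mpr ⟨f z, ⟨z, rfl⟩, x - f z, ?_, add_sub_cancel _ _⟩
    rw [LinearMap.mem_ker, map_sub, hf', hz, LinearEquiv.apply_symm_apply, sub_self]
  obtain ⟨g, hg⟩ := Module.projective_lifting_property f LinearMap.id hfs
  have hg' : ∀ x, f (g x) = x := fun x => LinearMap.congr_fun hg x
  have hgs : Function.Surjective g := by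
    rw [← LinearMap.range_eq_top]
    refine hsup _ (eq_top_iff.mpr fun x _ => ?_)
    refine Submodule.mem_sup.mpr ⟨g (f x), ⟨f x, rfl⟩, x - g (f x), ?_, add_sub_cancel _ _⟩
    rw [LinearMap.mem_ker, ← e.map_eq_zero_iff, ← hf', map_sub, hg', sub_self, map_zero]
  exact ⟨(LinearEquiv.ofBijective g ⟨Function.LeftInverse.injective hg', hgs⟩).symm⟩

/-- The Cartan determinant can be computed from any complete family of pairwise non-isomorphic
simple modules `P i ⧸ K i` with projective covers `P i`. -/
theorem cartanDet_eq_det [IsArtinianRing A] {I : Type*} [Fintype I] [DecidableEq I]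
    {P : I → Type u} [∀ i, AddCommGroup (P i)] [∀ i, Module A (P i)]
    (K : ∀ i, Submodule A (P i)) (hcover : ∀ i, IsProjectiveCover (K i).mkQ)
    (hK : ∀ i, IsCoatom (K i))
    (hne : ∀ i j, Nonempty ((P i ⧸ K i) ≃ₗ[A] (P j ⧸ K j)) → i = j)
    (hcomplete : ∀ J : Submodule A A, IsCoatom J → ∃ i, Nonempty ((A ⧸ J) ≃ₗ[A] (P i ⧸ K i)))
    (C : Matrix I I ℤ)
    (hC : ∀ i j (X S : Type u) [AddCommGroup X] [Module A X] [IsNoetherian A X] [IsArtinian A X]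
      [AddCommGroup S] [Module A S], Nonempty (X ≃ₗ[A] P i) → Nonempty (S ≃ₗ[A] (P j ⧸ K j)) →
      (compMultiplicity A X S : ℤ) = C i j) :
    cartanDet A = C.det := by
  choose f hf using fun S : SimpleClass A => hcomplete S.ideal S.isCoatom_ideal
  have hinj : Function.Injective f := by
    intro S T hST
    obtain ⟨a⟩ := hf S
    obtain ⟨b⟩ := hf T
    rw [hST] at a
    have h3 := Quotient.sound (s := simpleSetoid A)
      (a := Quotient.out (s := simpleSetoid A) S) (b := Quotient.out (s := simpleSetoid A) T)
      ⟨a.trans b.symm⟩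
    exact (Quotient.out_eq (s := simpleSetoid A) S).symm.trans
      (h3.trans (Quotient.out_eq (s := simpleSetoid A) T))
  have hsurj : Function.Surjective f := by
    intro i
    have hs : IsSimpleModule A (P i ⧸ K i) := isSimpleModule_iff_isCoatom.mpr (hK i)
    obtain ⟨J, hJ, ⟨e⟩⟩ := isSimpleModule_iff_quot_maximal.mp hs
    let S : SimpleClass A := Quotient.mk (simpleSetoid A) ⟨J, hJ.out⟩
    refine ⟨S, hne _ _ ?_⟩
    obtain ⟨a⟩ := hf S
    obtain ⟨b⟩ : Nonempty ((A ⧸ S.ideal) ≃ₗ[A] (A ⧸ J)) :=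
      Quotient.exact (s := simpleSetoid A) (Quotient.out_eq (s := simpleSetoid A) S)
    exact ⟨a.symm.trans (b.trans e.symm)⟩
  have hmat : (cartanMatrix A).map (Nat.cast : ℕ → ℤ) =
      C.submatrix (Equiv.ofBijective f ⟨hinj, hsurj⟩) (Equiv.ofBijective f ⟨hinj, hsurj⟩) := by
    ext S T
    obtain ⟨a⟩ := hf S
    exact hC _ _ _ _ (nonempty_equiv_of_isProjectiveCover S.isProjectiveCover (hcover (f S)) a)
      (hf T)
  rw [cartanDet, hmat, Matrix.det_submatrix_equiv_self]

/-- The number of composition factors isomorphic to `S` can be computed by a function on submodules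
that grows by one along factors isomorphic to `S` and is constant along the others. -/
theorem compMultiplicity_add_eq {X : Type v} {S : Type u} [AddCommGroup X] [Module A X]
    [IsNoetherian A X] [IsArtinian A X] [AddCommGroup S] [Module A S] (g : Submodule A X → ℕ)
    (h1 : ∀ N N' : Submodule A X, N ⋖ N' →
      Nonempty ((N' ⧸ N.comap N'.subtype) ≃ₗ[A] S) → g N' = g N + 1)
    (h0 : ∀ N N' : Submodule A X, N ⋖ N' →
      ¬ Nonempty ((N' ⧸ N.comap N'.subtype) ≃ₗ[A] S) → g N' = g N) :
    g ⊥ + compMultiplicity A X S = g ⊤ := by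
  classical
  have tele : ∀ (n : ℕ) (f : Fin (n + 1) → ℕ) (p : Fin n → Prop),
      (∀ i, f i.succ = f i.castSucc + if p i then 1 else 0) →
      f 0 + Nat.card {i // p i} = f (Fin.last n) := by
    intro n f p h
    rw [Nat.card_eq_fintype_card, Fintype.card_subtype, Finset.card_filter]
    induction n with
    | zero => simp
    | succ n ih =>
      have hih := ih (fun i => f i.castSucc) (fun i => p i.castSucc) fun i => h i.castSucc
      rw [Fin.sum_univ_castSucc, ← add_assoc]
      exact (congrArg (· + _) hih).trans (h (Fin.last n)).symm
  obtain ⟨hhead, hlast⟩ := compSeries_spec A X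
  rw [← hhead, ← hlast]
  refine tele _ (fun i => g (compSeries A X i)) _ fun i => ?_
  split_ifs with h
  · exact h1 _ _ ((compSeries A X).step i) h
  · exact h0 _ _ ((compSeries A X).step i) h

end ProjectiveCovers

/-! ### Simple and indecomposable projective modules over an endomorphism ring -/

section Simples

variable {D : Type*} [CommRing D] {M : Type u} [AddCommGroup M] [Module D M]
variable {A : Type u} [Ring A] [Module A M] [SMulCommClass A D M]

/-- The maximal submodule of `killedBy A M (p ^ (k + 1))`: it consists of the elements that are not
generators of level `k + 1`. -/
def nongenerators (A : Type*) (M : Type*) {D : Type*} [CommRing D] [AddCommGroup M] [Module D M]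
    [Ring A] [Module A M] [SMulCommClass A D M] (p : D) (k : ℕ) :
    Submodule A (killedBy A M (p ^ (k + 1))) where
  carrier := {m | ∃ x : M, p ^ (k + 1) • x = p ^ k • (m : M)}
  add_mem' := by
    rintro m n ⟨x, hx⟩ ⟨y, hy⟩
    exact ⟨x + y, by rw [smul_add, hx, hy, Submodule.coe_add, smul_add]⟩
  zero_mem' := ⟨0, by rw [smul_zero, Submodule.coe_zero, smul_zero]⟩
  smul_mem' := by
    rintro a m ⟨x, hx⟩
    exact ⟨a • x, by rw [← smul_comm a, hx, Submodule.coe_smul, smul_comm a]⟩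

theorem notMem_nongenerators {p : D} {k : ℕ} {m : killedBy A M (p ^ (k + 1))} :
    m ∉ nongenerators A M p k ↔ IsLevelGenerator p k (m : M) := by
  constructor
  · intro h
    exact ⟨m.2, fun x hx => h ⟨x, hx⟩⟩
  · rintro h ⟨x, hx⟩
    exact h.2 x hx

variable [IsDomain D] [IsPrincipalIdealRing D] [Module.Finite D M]

theorem le_nongenerators (hM : Module.IsTorsion D M) (hA : IsFullEnd A D M) {p : D}
    (hp : Irreducible p) {k : ℕ} {N : Submodule A (killedBy A M (p ^ (k + 1)))} (hN : N ≠ ⊤) :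
    N ≤ nongenerators A M p k := by
  intro m hm
  by_contra hmK
  obtain ⟨l, hl⟩ := (notMem_nongenerators.mp hmK).exists_functional hM hp
  obtain ⟨E, hE⟩ := hA.exists_rankOne l
  refine hN (eq_top_iff.mpr fun m' _ => ?_)
  have : m' = E m' • m := Subtype.ext (by
    rw [Submodule.coe_smul, hE m' m 1 (by rw [hl, map_one]), one_smul])
  rw [this]
  exact N.smul_mem _ hm

theorem isCoatom_nongenerators (hM : Module.IsTorsion D M) (hA : IsFullEnd A D M) {p : D}
    (hp : Irreducible p) {k : ℕ} {y : M} (hy : IsLevelGenerator p k y) :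
    IsCoatom (nongenerators A M p k) := by
  refine ⟨fun h => ?_, fun N hN => ?_⟩
  · have : (⟨y, hy.1⟩ : killedBy A M (p ^ (k + 1))) ∉ nongenerators A M p k :=
      notMem_nongenerators.mpr hy
    exact this (h ▸ Submodule.mem_top)
  · by_contra hNt
    exact absurd (le_nongenerators hM hA hp hNt) (not_le_of_gt hN)

theorem isProjectiveCover_nongenerators (hM : Module.IsTorsion D M) (hA : IsFullEnd A D M) {p : D}
    (hp : Irreducible p) {k : ℕ} {y : M} (hy : IsLevelGenerator p k y) :
    IsProjectiveCover (nongenerators A M p k).mkQ := by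
  obtain ⟨l, hl⟩ := hy.exists_functional hM hp
  obtain ⟨E, hE⟩ := hA.exists_rankOne l
  refine ⟨?_, Submodule.mkQ_surjective _, fun N hN => ?_⟩
  · refine Module.Projective.of_split E
      (LinearMap.toSpanSingleton A (killedBy A M (p ^ (k + 1))) ⟨y, hy.1⟩) ?_
    ext m
    change E m • y = m
    rw [hE m y 1 (by rw [hl, map_one]), one_smul]
  · by_contra hNt
    rw [Submodule.ker_mkQ, sup_eq_right.mpr (le_nongenerators hM hA hp hNt)] at hN
    exact (isCoatom_nongenerators hM hA hp hy).1 hN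

/-- A simple image of `killedBy A M (p ^ (k + 1))` is its top, since the submodule of nongenerators is
its only maximal submodule. -/
theorem nonempty_equiv_of_ne_zero (hM : Module.IsTorsion D M) (hA : IsFullEnd A D M) {p : D}
    (hp : Irreducible p) {k : ℕ} {y : M} (hy : IsLevelGenerator p k y) {S : Type*} [AddCommGroup S]
    [Module A S] [IsSimpleModule A S] {h : killedBy A M (p ^ (k + 1)) →ₗ[A] S} (hh : h ≠ 0) :
    Nonempty (S ≃ₗ[A] (killedBy A M (p ^ (k + 1)) ⧸ nongenerators A M p k)) := by
  have hsurj := LinearMap.surjective_of_ne_zero hh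
  have hle : LinearMap.ker h ≤ nongenerators A M p k :=
    le_nongenerators hM hA hp fun htop => hh (LinearMap.ker_eq_top.mp htop)
  have hco := LinearMap.isCoatom_ker_of_surjective hsurj
  have heq : LinearMap.ker h = nongenerators A M p k := by
    rcases hco.le_iff.mp hle with h1 | h1
    · exact absurd h1 (isCoatom_nongenerators hM hA hp hy).1
    · exact h1.symm
  exact ⟨((Submodule.quotEquivOfEq _ _ heq.symm).trans (h.quotKerEquivOfSurjective hsurj)).symm⟩

/-- Every simple module over the full endomorphism ring is the top of some `killedBy A M (f ^ i)`,
with `f` in a set of representatives of the irreducible elements. -/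
theorem exists_nonempty_equiv_of_isSimpleModule (hM : Module.IsTorsion D M) (hA : IsFullEnd A D M)
    {F : Set D} (hF : ∀ p : D, Irreducible p → ∀ k, (∃ y : M, IsLevelGenerator p k y) →
      ∃ f ∈ F, Associated p f) (S : Type*) [AddCommGroup S] [Module A S] [IsSimpleModule A S] :
    ∃ f ∈ F, ∃ k, (∃ y : M, IsLevelGenerator f k y) ∧
      Nonempty (S ≃ₗ[A] (killedBy A M (f ^ (k + 1)) ⧸ nongenerators A M f k)) := by
  classical
  obtain ⟨r, p, e, hpe, ⟨φ⟩⟩ := exists_primaryDecomposition hM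
  choose ε hε using fun i => hA.exists_smul_eq
    (φ.symm.toLinearMap ∘ₗ LinearMap.single D _ i ∘ₗ LinearMap.proj i ∘ₗ φ.toLinearMap)
  have hsum : ∑ i, ε i = 1 := hA.ext fun m => by
    rw [Finset.sum_smul, one_smul]
    simp_rw [hε]
    apply φ.injective
    rw [map_sum]
    simp only [LinearMap.comp_apply, LinearEquiv.coe_coe, LinearEquiv.apply_symm_apply,
      LinearMap.coe_single, LinearMap.proj_apply]
    exact Finset.univ_sum_single (φ m)
  have := IsSimpleModule.nontrivial A S
  obtain ⟨s, hs⟩ := exists_ne (0 : S)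
  obtain ⟨i, hi⟩ : ∃ i, ε i • s ≠ 0 := by
    by_contra hcon
    push Not at hcon
    refine hs ?_
    rw [← one_smul A s, ← hsum, Finset.sum_smul]
    exact Finset.sum_eq_zero fun i _ => hcon i
  obtain ⟨k, hk⟩ : ∃ k, e i = k + 1 := ⟨e i - 1, by have := (hpe i).2; omega⟩
  have hy := isLevelGenerator_single φ (fun i => (hpe i).1) hk
  obtain ⟨f, hf, hass⟩ := hF _ (hpe i).1 k ⟨_, hy⟩
  have hy' := hy.of_associated hass
  have hspan : Ideal.span {p i ^ e i} = Ideal.span {f ^ (k + 1)} := by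
    rw [Ideal.span_singleton_eq_span_singleton, hk]
    exact hass.pow_pow
  obtain ⟨E, hE⟩ := hA.exists_rankOne ((Submodule.quotEquivOfEq _ _ hspan).toLinearMap ∘ₗ
    LinearMap.proj i ∘ₗ φ.toLinearMap)
  have hEy : E ⟨_, hy'.1⟩ = ε i := hA.ext fun x => by
    obtain ⟨d, hd⟩ := Ideal.Quotient.mk_surjective (φ x i)
    rw [hE _ x d, hε]
    · change _ = φ.symm (Pi.single i (φ x i))
      rw [← map_smul, ← Pi.single_smul, ← hd]
      congr 2
      change Ideal.Quotient.mk _ (d * 1) = _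
      rw [mul_one]
    · change Submodule.quotEquivOfEq _ _ hspan (φ x i) = _
      rw [← hd]
      rfl
  refine ⟨f, hf, k, ⟨_, hy'⟩, nonempty_equiv_of_ne_zero hM hA (hass.irreducible (hpe i).1) hy'
    (h := (LinearMap.toSpanSingleton A S s) ∘ₗ E) fun h0 => hi ?_⟩
  rw [← hEy]
  exact LinearMap.congr_fun h0 _

/-- A multiple of a level generator is a level generator only for the same level. -/
theorem IsLevelGenerator.eq_of_smul (hM : Module.IsTorsion D M) {p q : D} (hp : Irreducible p)
    (hq : Irreducible q) {k l : ℕ} {y : M} (hy : IsLevelGenerator p k y) {d : D}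
    (hd : IsLevelGenerator q l (d • y)) : Associated p q ∧ k = l := by
  have hass : Associated p q := by
    by_contra hass
    refine hd.pow_smul_ne_zero ?_
    rw [eq_zero_of_coprime_smul (coprime_pow_of_not_associated hp hq hass (k + 1) (l + 1))
      (by rw [smul_comm, hy.1, smul_zero]) hd.1, smul_zero]
  have hd' := hd.of_associated hass.symm
  refine ⟨hass, le_antisymm ?_ ?_⟩
  · by_contra hlt
    obtain ⟨f, hf⟩ := hy.exists_functional hM hp
    have h1 : f (p ^ (l + 1) • d • y) = 0 := by rw [hd'.1, map_zero]
    rw [map_smul, map_smul, hf] at h1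
    change Ideal.Quotient.mk _ (p ^ (l + 1) * (d * 1)) = 0 at h1
    rw [Ideal.Quotient.eq_zero_iff_mem, Ideal.mem_span_singleton, mul_one,
      show k + 1 = l + 1 + (k - l - 1 + 1) by omega, pow_add,
      mul_dvd_mul_iff_left (pow_ne_zero _ hp.ne_zero)] at h1
    obtain ⟨c, rfl⟩ := (dvd_pow_self p (Nat.succ_ne_zero _)).trans h1
    refine hd'.2 (c • y) ?_
    rw [← mul_smul, ← mul_smul]
    congr 1
    ring
  · by_contra hlt
    refine hd'.pow_smul_ne_zero ?_
    rw [smul_comm, show l = l - k - 1 + (k + 1) by omega, pow_add, mul_smul, hy.1, smul_zero,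
      smul_zero]

theorem associated_and_eq_of_nonempty_equiv (hM : Module.IsTorsion D M) (hA : IsFullEnd A D M)
    {p q : D} (hp : Irreducible p) (hq : Irreducible q) {k l : ℕ} {y : M}
    (hy : IsLevelGenerator p k y)
    (h : Nonempty ((killedBy A M (p ^ (k + 1)) ⧸ nongenerators A M p k) ≃ₗ[A]
      (killedBy A M (q ^ (l + 1)) ⧸ nongenerators A M q l))) : Associated p q ∧ k = l := by
  obtain ⟨θ⟩ := h
  obtain ⟨f, hf⟩ := hy.exists_functional hM hp
  obtain ⟨E, hE⟩ := hA.exists_rankOne f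
  let y' : killedBy A M (p ^ (k + 1)) := ⟨y, hy.1⟩
  have hEy : E y' • y' = y' := Subtype.ext (by
    rw [Submodule.coe_smul, hE y' y' 1 (by rw [map_one]; exact hf), one_smul])
  obtain ⟨m, hm⟩ := Submodule.mkQ_surjective _ (θ (Submodule.Quotient.mk y'))
  have hmem : E y' • m ∉ nongenerators A M q l := by
    rw [← Submodule.Quotient.mk_eq_zero, Submodule.Quotient.mk_smul, ← Submodule.mkQ_apply, hm,
      ← map_smul, ← Submodule.Quotient.mk_smul, hEy, LinearEquiv.map_eq_zero_iff,
      Submodule.Quotient.mk_eq_zero]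
    exact notMem_nongenerators.mpr hy
  obtain ⟨d, hd⟩ := Ideal.Quotient.mk_surjective (f m)
  have hgen := notMem_nongenerators.mp hmem
  rw [Submodule.coe_smul, hE y' m d hd.symm] at hgen
  exact hy.eq_of_smul hM hp hq hgen

/-- A generator `y` of level `k + 1` at `p` spans the image of a primitive idempotent `e`.  For an
`A`-submodule `N` of `M` the `D`-module `e N = N ∩ D y` is generated by some `p ^ t • y`, and along a
composition factor it grows if and only if the factor is the simple module belonging to `y`.  So the
multiplicity of this simple module in `X ⊆ M` is the number of `t ≤ k` with `p ^ t • y ∈ X`. -/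
theorem compMultiplicity_eq_card (hM : Module.IsTorsion D M) (hA : IsFullEnd A D M)
    {p : D} (hp : Irreducible p) {k : ℕ} {y : M} (hy : IsLevelGenerator p k y)
    {X : Type v} {S : Type u} [AddCommGroup X] [Module A X] [IsNoetherian A X] [IsArtinian A X]
    [AddCommGroup S] [Module A S] (j : X →ₗ[A] M) (hj : Function.Injective j)
    (θ : S ≃ₗ[A] (killedBy A M (p ^ (k + 1)) ⧸ nongenerators A M p k)) :
    compMultiplicity A X S = Nat.card {t : ℕ // t ≤ k ∧ p ^ t • y ∈ LinearMap.range j} := by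
  classical
  obtain ⟨f, hf⟩ := hy.exists_functional hM hp
  obtain ⟨E, hE⟩ := hA.exists_rankOne f
  let y' : killedBy A M (p ^ (k + 1)) := ⟨y, hy.1⟩
  have hEy : E y' • y = y := by rw [hE y' y 1 (by rw [map_one]; exact hf), one_smul]
  choose c hc using fun d : D => hA.exists_smul_eq (LinearMap.lsmul D M d)
  replace hc : ∀ (d : D) (m : M), c d • m = d • m := hc
  have hDmem : ∀ (N : Submodule A M) (d : D) {m : M}, m ∈ N → d • m ∈ N := fun N d m hm => by
    rw [← hc]
    exact N.smul_mem _ hm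
  let T : Submodule A X → Finset ℕ := fun N =>
    (Finset.range (k + 1)).filter fun t => p ^ t • y ∈ N.map j
  have hT : ∀ N t, t ∈ T N ↔ t < k + 1 ∧ p ^ t • y ∈ N.map j := fun N t => by
    simp only [T, Finset.mem_filter, Finset.mem_range]
  have key := compMultiplicity_add_eq (A := A) (X := X) (S := S) (fun N => (T N).card) ?_ ?_
  · have hbot : T ⊥ = ∅ := by
      rw [Finset.eq_empty_iff_forall_notMem]
      intro t ht
      rw [hT, Submodule.map_bot, Submodule.mem_bot] at ht
      refine hy.pow_smul_ne_zero ?_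
      rw [show k = k - t + t by omega, pow_add, mul_smul, ht.2, smul_zero]
    simp only [hbot, Finset.card_empty, zero_add] at key
    rw [key]
    symm
    refine Nat.subtype_card _ fun t => ?_
    rw [hT, Submodule.map_top, Nat.lt_succ_iff]
  · rintro N N' hcov ⟨θ'⟩
    have hpN : ∀ n ∈ N', c p • n ∈ N := by
      intro n hn
      have h1 : c p • (Submodule.Quotient.mk ⟨n, hn⟩ : N' ⧸ N.comap N'.subtype) = 0 := by
        apply (θ'.trans θ).injective
        rw [map_smul, map_zero]
        obtain ⟨m, hm⟩ := Submodule.mkQ_surjective _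
          ((θ'.trans θ) (Submodule.Quotient.mk ⟨n, hn⟩))
        rw [← hm, ← map_smul, Submodule.mkQ_apply, Submodule.Quotient.mk_eq_zero]
        refine ⟨0, ?_⟩
        rw [Submodule.coe_smul, hc, ← mul_smul, ← pow_succ, smul_zero]
        exact m.2.symm
      rw [← Submodule.Quotient.mk_smul, Submodule.Quotient.mk_eq_zero] at h1
      exact h1
    obtain ⟨⟨n, hn⟩, hnθ⟩ := Submodule.mkQ_surjective _
      ((θ'.trans θ).symm (Submodule.Quotient.mk y'))
    have hen : E y' • n ∉ N := by
      intro hmem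
      have h1 : E y' • (Submodule.Quotient.mk ⟨n, hn⟩ : N' ⧸ N.comap N'.subtype) = 0 := by
        rw [← Submodule.Quotient.mk_smul, Submodule.Quotient.mk_eq_zero]
        exact hmem
      rw [← Submodule.mkQ_apply, hnθ, ← map_smul, LinearEquiv.map_eq_zero_iff,
        ← Submodule.Quotient.mk_smul, show E y' • y' = y' from Subtype.ext hEy,
        Submodule.Quotient.mk_eq_zero] at h1
      exact notMem_nongenerators.mpr hy h1
    obtain ⟨d, hd⟩ := Ideal.Quotient.mk_surjective (f (j n))
    have hjn : j (E y' • n) = d • y := by rw [map_smul, hE y' (j n) d hd.symm]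
    have hd0 : d ≠ 0 := by
      rintro rfl
      rw [zero_smul, ← map_zero j] at hjn
      exact hen (hj hjn ▸ N.zero_mem)
    obtain ⟨s, hds, hps⟩ :=
      (FiniteMultiplicity.of_not_isUnit hp.not_isUnit hd0).exists_eq_pow_mul_and_not_dvd
    generalize multiplicity p d = t₀ at hds
    have hN : p ^ t₀ • y ∉ N.map j := by
      intro hmem
      have h1 : d • y ∈ N.map j := by
        rw [hds, mul_comm, mul_smul]
        exact hDmem _ s hmem
      obtain ⟨n', hn', hn'j⟩ := h1
      rw [← hjn] at hn'j
      exact hen (hj hn'j ▸ hn')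
    have ht₀ : t₀ < k + 1 := by
      by_contra hlt
      refine hN ?_
      rw [show t₀ = t₀ - (k + 1) + (k + 1) by omega, pow_add, mul_smul, hy.1, smul_zero]
      exact Submodule.zero_mem _
    have hN' : p ^ t₀ • y ∈ N'.map j := by
      obtain ⟨a, b, hab⟩ := IsCoprime.pow_left (m := k + 1) ((hp.coprime_iff_not_dvd).mpr hps)
      have h1 : p ^ t₀ • y = b • d • y := by
        rw [hds, ← one_smul D (p ^ t₀ • y), ← hab, add_smul, mul_smul, smul_comm _ (p ^ t₀), hy.1,
          smul_zero, smul_zero, zero_add, ← mul_smul, ← mul_smul]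
        congr 1
        ring
      rw [h1]
      exact hDmem _ b ⟨E y' • n, N'.smul_mem _ hn, hjn⟩
    have hstep : ∀ t, p ^ t • y ∈ N'.map j → ∀ t', t < t' → p ^ t' • y ∈ N.map j := by
      rintro t ⟨n', hn', hnj⟩ t' htt'
      rw [show t' = t' - (t + 1) + 1 + t by omega, pow_add, mul_smul, pow_succ, mul_smul, ← hnj,
        ← hc p, ← map_smul]
      exact hDmem _ _ ⟨_, hpN n' hn', rfl⟩
    have hins : T N' = insert t₀ (T N) := by
      ext t
      rw [Finset.mem_insert, hT, hT]
      constructor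
      · rintro ⟨htk, htN'⟩
        rcases lt_trichotomy t t₀ with hlt | rfl | hlt
        · exact absurd (hstep t htN' _ hlt) hN
        · exact Or.inl rfl
        · exact Or.inr ⟨htk, hstep _ hN' _ hlt⟩
      · rintro (rfl | ⟨htk, htN⟩)
        · exact ⟨ht₀, hN'⟩
        · exact ⟨htk, Submodule.map_mono hcov.le htN⟩
    change (T N').card = (T N).card + 1
    rw [hins, Finset.card_insert_of_notMem fun h => hN ((hT _ _).mp h).2]
  · intro N N' hcov hno
    congr 1
    refine le_antisymm (fun t ht => ?_) fun t ht => ?_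
    · by_contra hnot
      rw [hT] at ht hnot
      obtain ⟨htk, u, hu, huj⟩ := ht
      have huN : u ∉ N := fun h => hnot ⟨htk, u, h, huj⟩
      have hEu : E y' • u = u := hj (by rw [map_smul, huj, smul_comm, hEy])
      have := (covBy_iff_quot_is_simple hcov.le).mp hcov
      let h : killedBy A M (p ^ (k + 1)) →ₗ[A] (N' ⧸ N.comap N'.subtype) :=
        (LinearMap.toSpanSingleton A _ (Submodule.Quotient.mk ⟨u, hu⟩)) ∘ₗ E
      obtain ⟨θ'⟩ := nonempty_equiv_of_ne_zero hM hA hp hy (h := h) fun h0 => by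
        have h1 : E y' • (Submodule.Quotient.mk ⟨u, hu⟩ : N' ⧸ N.comap N'.subtype) = 0 :=
          LinearMap.congr_fun h0 y'
        rw [← Submodule.Quotient.mk_smul, Submodule.Quotient.mk_eq_zero] at h1
        have h2 : E y' • u ∈ N := h1
        exact huN (hEu ▸ h2)
      exact hno ⟨θ'.trans θ.symm⟩
    · rw [hT] at ht ⊢
      exact ⟨ht.1, Submodule.map_mono hcov.le ht.2⟩

end Simples

/-! ### The determinant of a matrix of minima -/

section Gaps

theorem det_blockDiagonal_sigma {o : Type*} [Fintype o] [DecidableEq o] {m : o → Type*}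
    [∀ i, Fintype (m i)] [∀ i, DecidableEq (m i)] (B : ∀ i, Matrix (m i) (m i) ℤ) :
    (Matrix.blockDiagonal' B).det = ∏ i, (B i).det := by
  let _ : LinearOrder o := LinearOrder.lift' (Fintype.equivFin o) (Equiv.injective _)
  rw [(Matrix.blockTriangular_blockDiagonal' B).det_fintype]
  refine Finset.prod_congr rfl fun i _ => ?_
  rw [← Matrix.det_submatrix_equiv_self (Equiv.sigmaSubtype i).symm]
  congr 1
  ext a b
  exact Matrix.blockDiagonal'_apply_eq B i a b

theorem sum_gaps_filter_le (T : Finset ℕ) (a : ℕ) (ha : a ∈ T) :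
    ∑ t ∈ T.filter (· ≤ a), (t - (T.filter (· < t)).sup id) = a := by
  induction a using Nat.strong_induction_on with
  | _ a ih =>
    have hins : T.filter (· ≤ a) = insert a (T.filter (· < a)) := by
      ext t
      simp only [Finset.mem_filter, Finset.mem_insert]
      constructor
      · rintro ⟨h1, h2⟩
        rcases h2.eq_or_lt with h | h
        · exact Or.inl h
        · exact Or.inr ⟨h1, h⟩
      · rintro (rfl | ⟨h1, h2⟩)
        · exact ⟨ha, le_rfl⟩
        · exact ⟨h1, h2.le⟩
    rw [hins, Finset.sum_insert (by simp)]
    rcases (T.filter (· < a)).eq_empty_or_nonempty with he | hne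
    · rw [he]
      simp
    · obtain ⟨b, hb, hsup⟩ := Finset.exists_mem_eq_sup _ hne (id : ℕ → ℕ)
      have hb' := Finset.mem_filter.mp hb
      have hfil : T.filter (· < a) = T.filter (· ≤ b) := by
        ext t
        simp only [Finset.mem_filter]
        refine ⟨fun ⟨h1, h2⟩ => ⟨h1, ?_⟩, fun ⟨h1, h2⟩ => ⟨h1, lt_of_le_of_lt h2 hb'.2⟩⟩
        rw [← show _ = b from hsup]
        exact Finset.le_sup (f := (id : ℕ → ℕ)) (Finset.mem_filter.mpr ⟨h1, h2⟩)
      rw [hsup, hfil, ih b hb'.2 hb'.1]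
      exact Nat.sub_add_cancel hb'.2.le

/-- The matrix of minima is `L * diagonal g * Lᵀ`, where `L` is the unitriangular matrix of the
order relation of `T` and `g` are the gaps of `T`. -/
theorem det_min_eq_prod_gaps (T : Finset ℕ) :
    (Matrix.of fun a b : T => ((min (a : ℕ) b : ℕ) : ℤ)).det = ((gaps T).prod : ℤ) := by
  classical
  let g : T → ℤ := fun t => ((t - (T.filter (· < (t : ℕ))).sup id : ℕ) : ℤ)
  let L : Matrix T T ℤ := Matrix.of fun a t => if t ≤ a then 1 else 0
  have hL : L.det = 1 := by
    rw [Matrix.det_of_isLowerTriangular L fun a b hab => if_neg (not_le.mpr hab)]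
    exact Finset.prod_eq_one fun a _ => if_pos le_rfl
  have hmul : (Matrix.of fun a b : T => ((min (a : ℕ) b : ℕ) : ℤ)) =
      L * Matrix.diagonal g * L.transpose := by
    ext a b
    rw [Matrix.mul_apply]
    simp only [Matrix.mul_diagonal, Matrix.transpose_apply, L, Matrix.of_apply]
    have hmin : min (a : ℕ) b ∈ T := by
      rcases min_choice (a : ℕ) b with h | h <;> rw [h]
      · exact a.2
      · exact b.2
    have h1 := sum_gaps_filter_le T _ hmin
    rw [← h1, Finset.sum_filter, ← Finset.sum_coe_sort, Nat.cast_sum]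
    refine Finset.sum_congr rfl fun t _ => ?_
    simp only [le_min_iff, Subtype.coe_le_coe, g]
    by_cases hta : t ≤ a <;> by_cases htb : t ≤ b <;> simp [hta, htb]
  rw [hmul, Matrix.det_mul, Matrix.det_mul, Matrix.det_transpose, hL, Matrix.det_diagonal, one_mul,
    mul_one, gaps]
  change _ = ((∏ t ∈ T, (t - (T.filter (· < t)).sup id) : ℕ) : ℤ)
  rw [Nat.cast_prod]
  exact Finset.prod_coe_sort T fun t => ((t - (T.filter (· < t)).sup id : ℕ) : ℤ)

theorem prod_nontrivialGaps (T : Finset ℕ) : (nontrivialGaps T).prod = (gaps T).prod := by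
  rw [nontrivialGaps]
  induction gaps T using Multiset.induction_on with
  | empty => rfl
  | cons a s ih =>
    by_cases ha : a = 1
    · rw [Multiset.filter_cons_of_neg s (by simpa using ha), ih, Multiset.prod_cons, ha, one_mul]
    · rw [Multiset.filter_cons_of_pos s ha, Multiset.prod_cons, Multiset.prod_cons, ih]

/-- A set of `s` positive integers with maximum `s` is `{1, …, s}`. -/
theorem eq_Icc_of_card_eq_sup {T : Finset ℕ} (h0 : 0 ∉ T) (h : T.card = T.sup id) :
    T = Finset.Icc 1 (T.sup id) := by
  refine Finset.eq_of_subset_of_card_le (fun t ht => ?_) ?_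
  · exact Finset.mem_Icc.mpr ⟨Nat.pos_of_ne_zero fun h => h0 (h ▸ ht),
      Finset.le_sup (f := (id : ℕ → ℕ)) ht⟩
  · rw [Nat.card_Icc, h, Nat.add_sub_cancel]

theorem prod_gaps_eq_one {T : Finset ℕ} (h0 : 0 ∉ T) (h : T.card = T.sup id) :
    (gaps T).prod = 1 := by
  have hT := eq_Icc_of_card_eq_sup h0 h
  change ∏ t ∈ T, (t - (T.filter (· < t)).sup id) = 1
  refine Finset.prod_eq_one fun t ht => ?_
  have ht1 : 1 ≤ t := Nat.pos_of_ne_zero fun h => h0 (h ▸ ht)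
  have hsup : (T.filter (· < t)).sup id = t - 1 := by
    refine le_antisymm (Finset.sup_le fun s hs => ?_) ?_
    · have := (Finset.mem_filter.mp hs).2
      change s ≤ t - 1
      omega
    · rcases Nat.eq_zero_or_pos (t - 1) with h1 | h1
      · rw [h1]; exact Nat.zero_le _
      · refine Finset.le_sup (f := (id : ℕ → ℕ)) (Finset.mem_filter.mpr ⟨?_, by omega⟩)
        rw [hT, Finset.mem_Icc] at ht ⊢
        omega
  rw [hsup]
  omega

end Gaps

/-! ### The Cartan determinant of an endomorphism ring -/

section CartanDeterminant

variable {D : Type*} [CommRing D] {M : Type u} [AddCommGroup M] [Module D M]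
variable {A : Type u} [Ring A] [Module A M] [SMulCommClass A D M]
theorem IsLevelGenerator.card_pow_smul_mem_killedBy {p : D} {k l : ℕ} {y : M}
    (hy : IsLevelGenerator p k y) :
    Nat.card {t : ℕ // t ≤ k ∧ p ^ t • y ∈ killedBy A M (p ^ (l + 1))} =
      min (l + 1) (k + 1) := by
  have h : ∀ t, t ≤ k ∧ p ^ t • y ∈ killedBy A M (p ^ (l + 1)) ↔ k - l ≤ t ∧ t ≤ k := by
    intro t
    rw [mem_killedBy, ← mul_smul, ← pow_add, and_comm]
    refine and_congr_left fun htk => ⟨fun h0 => ?_, fun h1 => ?_⟩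
    · by_contra hlt
      refine hy.pow_smul_ne_zero ?_
      rw [show k = k - (l + 1 + t) + (l + 1 + t) by omega, pow_add, mul_smul, h0, smul_zero]
    · rw [show l + 1 + t = l + 1 + t - (k + 1) + (k + 1) by omega, pow_add, mul_smul, hy.1,
        smul_zero]
  rw [Nat.subtype_card (Finset.Icc (k - l) k) fun t => by rw [Finset.mem_Icc, h], Nat.card_Icc]
  omega

theorem IsLevelGenerator.card_pow_smul_mem_killedBy_of_not_associated
    [IsPrincipalIdealRing D] {p q : D}
    (hp : Irreducible p) (hq : Irreducible q) (hpq : ¬ Associated p q) {k l : ℕ} {y : M}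
    (hy : IsLevelGenerator p k y) :
    Nat.card {t : ℕ // t ≤ k ∧ p ^ t • y ∈ killedBy A M (q ^ l)} = 0 := by
  refine Nat.subtype_card ∅ fun t => ⟨fun h => absurd h (Finset.notMem_empty _), ?_⟩
  rintro ⟨htk, ht⟩
  refine absurd ?_ hy.pow_smul_ne_zero
  have h0 : p ^ t • y = 0 :=
    eq_zero_of_coprime_smul (coprime_pow_of_not_associated hp hq hpq (k + 1) l)
      (by rw [smul_comm, hy.1, smul_zero]) ht
  rw [show k = k - t + t by omega, pow_add, mul_smul, h0, smul_zero]

variable [IsDomain D] [IsPrincipalIdealRing D] [Module.Finite D M]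

/-- The Cartan matrix is block diagonal, with one block of minima for each irreducible `f` that
occurs in the elementary divisors of `M`. -/
theorem IsFullEnd.cartanDet_eq [IsArtinianRing A] (hM : Module.IsTorsion D M)
    (hA : IsFullEnd A D M) (F : Finset D) (hirr : ∀ f ∈ F, Irreducible f)
    (hass : ∀ f ∈ F, ∀ g ∈ F, Associated f g → f = g)
    (hF : ∀ p : D, Irreducible p → ∀ k, (∃ y : M, IsLevelGenerator p k y) →
      ∃ f ∈ F, Associated p f)
    (P : D → Finset ℕ) (hP : ∀ f ∈ F, ∀ i, i ∈ P f ↔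
      ∃ k, i = k + 1 ∧ ∃ y : M, IsLevelGenerator f k y) :
    cartanDet A = ∏ f ∈ F, ((gaps (P f)).prod : ℤ) := by
  classical
  have hex : ∀ i : Σ f : F, P f, ∃ k, (i.2 : ℕ) = k + 1 ∧
    ∃ y : M, IsLevelGenerator (i.1 : D) k y := fun i => (hP i.1 i.1.2 i.2).mp i.2.2
  choose k hk y hy using hex
  have hp : ∀ i : Σ f : F, P f, Irreducible (i.1 : D) := fun i => hirr _ i.1.2
  have hdet := cartanDet_eq_det (A := A) (I := Σ f : F, P f)
    (P := fun i => killedBy A M ((i.1 : D) ^ (k i + 1)))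
    (fun i => nongenerators A M (i.1 : D) (k i))
    (fun i => isProjectiveCover_nongenerators hM hA (hp i) (hy i))
    (fun i => isCoatom_nongenerators hM hA (hp i) (hy i)) ?_ ?_
    (Matrix.blockDiagonal' fun f : F => Matrix.of fun a b : P f => ((min (a : ℕ) b : ℕ) : ℤ)) ?_
  · rw [hdet, det_blockDiagonal_sigma]
    simp_rw [det_min_eq_prod_gaps]
    exact Finset.prod_coe_sort F fun f => ((gaps (P f)).prod : ℤ)
  · intro i j h
    obtain ⟨h1, h2⟩ := associated_and_eq_of_nonempty_equiv hM hA (hp i) (hp j) (hy i) h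
    have h3 : i.1 = j.1 := Subtype.ext (hass _ i.1.2 _ j.1.2 h1)
    have h4 : (i.2 : ℕ) = j.2 := by rw [hk, hk, h2]
    obtain ⟨f, a⟩ := i
    obtain ⟨g, b⟩ := j
    obtain rfl : f = g := h3
    obtain rfl : a = b := Subtype.ext h4
    rfl
  · intro J hJ
    have : IsSimpleModule A (A ⧸ J) := isSimpleModule_iff_isCoatom.mpr hJ
    obtain ⟨f, hf, l, hl, he⟩ := exists_nonempty_equiv_of_isSimpleModule hM hA
      (F := (F : Set D)) (fun p hp k h => hF p hp k h) (A ⧸ J)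
    refine ⟨⟨⟨f, hf⟩, ⟨l + 1, (hP f hf _).mpr ⟨l, rfl, hl⟩⟩⟩, ?_⟩
    have hkl := hk ⟨⟨f, hf⟩, ⟨l + 1, (hP f hf _).mpr ⟨l, rfl, hl⟩⟩⟩
    have hkl' := Nat.succ.inj hkl
    rw [← hkl']
    exact he
  · rintro i j X S _ _ _ _ _ _ ⟨e⟩ ⟨θ⟩
    rw [compMultiplicity_eq_card hM hA (hp j) (hy j)
      ((killedBy A M ((i.1 : D) ^ (k i + 1))).subtype ∘ₗ e.toLinearMap)
      ((Submodule.injective_subtype _).comp e.injective) θ, LinearMap.range_comp,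
      LinearEquiv.range, Submodule.map_top, Submodule.range_subtype]
    obtain ⟨f, a⟩ := i
    obtain ⟨g, b⟩ := j
    by_cases hfg : f = g
    · subst hfg
      rw [Matrix.blockDiagonal'_apply_eq, Matrix.of_apply,
        (hy ⟨f, b⟩).card_pow_smul_mem_killedBy, ← hk ⟨f, a⟩, ← hk ⟨f, b⟩]
    · rw [Matrix.blockDiagonal'_apply_ne _ _ _ hfg,
        (hy ⟨g, b⟩).card_pow_smul_mem_killedBy_of_not_associated (hp ⟨g, b⟩) (hp ⟨f, a⟩)
          fun h => hfg (Subtype.ext (hass _ g.2 _ f.2 h)).symm, Nat.cast_zero]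

end CartanDeterminant

/-! ### The centralizer of a matrix as an endomorphism ring -/

section Matrices

variable {R : Type u} [Field R] {n : ℕ} (c : Matrix (Fin n) (Fin n) R)

/-- A matrix that commutes with `c`, as an endomorphism of the `R[X]`-module defined by `c`. -/
noncomputable def centralizerEnd (a : centralizerAlgebra c) : Module.End R[X] (matrixModule c) :=
  LinearMap.ofAEval (Matrix.toLin' c)
    ((Module.AEval'.of (Matrix.toLin' c)).toLinearMap ∘ₗ Matrix.toLin' (a : Matrix _ _ R))
    fun v => by
      have h : c * a = a * c := (Subalgebra.mem_centralizer_iff R).mp a.2 c rfl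
      simp only [LinearMap.comp_apply, LinearEquiv.coe_coe]
      rw [Module.AEval'.X_smul_of, Module.End.smul_def, ← LinearMap.comp_apply,
        ← LinearMap.comp_apply, ← Matrix.toLin'_mul, ← Matrix.toLin'_mul, h]

theorem centralizerEnd_of (a : centralizerAlgebra c) (v : Fin n → R) :
    centralizerEnd c a (Module.AEval'.of (Matrix.toLin' c) v) =
      Module.AEval'.of (Matrix.toLin' c) (Matrix.toLin' (a : Matrix _ _ R) v) := rfl

theorem end_matrixModule_ext {φ ψ : Module.End R[X] (matrixModule c)}
    (h : ∀ v, φ (Module.AEval'.of (Matrix.toLin' c) v) = ψ (Module.AEval'.of (Matrix.toLin' c) v)) :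
    φ = ψ := LinearMap.ext fun x => by
  obtain ⟨v, rfl⟩ := (Module.AEval'.of (Matrix.toLin' c)).surjective x
  exact h v

/-- The action of the centralizer algebra on the `R[X]`-module defined by `c`. -/
noncomputable def centralizerToEnd :
    centralizerAlgebra c →+* Module.End R[X] (matrixModule c) where
  toFun := centralizerEnd c
  map_one' := end_matrixModule_ext c fun v => by
    rw [centralizerEnd_of, OneMemClass.coe_one, Matrix.toLin'_one]
    rfl
  map_mul' a b := end_matrixModule_ext c fun v => by
    rw [Module.End.mul_apply, centralizerEnd_of, centralizerEnd_of, centralizerEnd_of,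
      MulMemClass.coe_mul, Matrix.toLin'_mul, LinearMap.comp_apply]
  map_zero' := end_matrixModule_ext c fun v => by
    rw [centralizerEnd_of, ZeroMemClass.coe_zero, map_zero, LinearMap.zero_apply, map_zero]
    rfl
  map_add' a b := end_matrixModule_ext c fun v => by
    rw [LinearMap.add_apply, centralizerEnd_of, centralizerEnd_of, centralizerEnd_of,
      AddMemClass.coe_add, map_add, LinearMap.add_apply, map_add]

noncomputable instance : Module (centralizerAlgebra c) (matrixModule c) :=
  Module.compHom _ (centralizerToEnd c)

instance : SMulCommClass (centralizerAlgebra c) R[X] (matrixModule c) :=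
  ⟨fun a d x => (centralizerToEnd c a).map_smul d x⟩

theorem centralizer_smul_of (a : centralizerAlgebra c) (v : Fin n → R) :
    a • Module.AEval'.of (Matrix.toLin' c) v =
      Module.AEval'.of (Matrix.toLin' c) (Matrix.toLin' (a : Matrix _ _ R) v) := rfl

theorem isFullEnd_centralizerAlgebra :
    IsFullEnd (centralizerAlgebra c) R[X] (matrixModule c) := by
  constructor
  · intro a b hab
    apply Subtype.ext
    apply Matrix.toLin'.injective
    refine LinearMap.ext fun v => ?_
    have h := LinearMap.congr_fun hab (Module.AEval'.of (Matrix.toLin' c) v)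
    exact (Module.AEval'.of (Matrix.toLin' c)).injective h
  · intro φ
    let ψ : (Fin n → R) →ₗ[R] (Fin n → R) :=
      (Module.AEval'.of (Matrix.toLin' c)).symm.toLinearMap ∘ₗ φ.restrictScalars R ∘ₗ
        (Module.AEval'.of (Matrix.toLin' c)).toLinearMap
    have hψ : ∀ v, Module.AEval'.of (Matrix.toLin' c) (ψ v) =
        φ (Module.AEval'.of (Matrix.toLin' c) v) := fun v => rfl
    have hcomm : c * LinearMap.toMatrix' ψ = LinearMap.toMatrix' ψ * c := by
      apply Matrix.toLin'.injective
      rw [Matrix.toLin'_mul, Matrix.toLin'_mul, Matrix.toLin'_toMatrix']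
      refine LinearMap.ext fun v => ?_
      apply (Module.AEval'.of (Matrix.toLin' c)).injective
      change Module.AEval'.of (Matrix.toLin' c) (Matrix.toLin' c (ψ v)) =
        Module.AEval'.of (Matrix.toLin' c) (ψ (Matrix.toLin' c v))
      rw [hψ, ← Module.AEval'.X_smul_of,
        ← Module.AEval'.X_smul_of, hψ, map_smul]
    refine ⟨⟨LinearMap.toMatrix' ψ, (Subalgebra.mem_centralizer_iff R).mpr ?_⟩, ?_⟩
    · rintro _ rfl
      exact hcomm
    · refine end_matrixModule_ext c fun v => ?_
      refine (centralizer_smul_of c _ v).trans ?_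
      rw [Matrix.toLin'_toMatrix', hψ]

theorem isTorsion_matrixModule : Module.IsTorsion R[X] (matrixModule c) :=
  Module.AEval.isTorsion_of_finiteDimensional _ _ _

/-! ### Elementary divisors and power indices -/

theorem eq_and_eq_of_pow_eq_pow {p q : R[X]} (hp : p.Monic) (hpi : Irreducible p) (hq : q.Monic)
    (hqi : Irreducible q) {i j : ℕ} (h : p ^ (i + 1) ∣ q ^ j) : p = q ∧ i + 1 ≤ j := by
  have hpq : p = q := by
    have h1 : p ∣ q := hpi.prime.dvd_of_dvd_pow ((dvd_pow_self p (Nat.succ_ne_zero i)).trans h)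
    exact eq_of_monic_of_associated hp hq (hpi.associated_of_dvd hqi h1)
  subst hpq
  exact ⟨rfl, (pow_dvd_pow_iff hpi.ne_zero hpi.not_isUnit).mp h⟩

variable {c}

theorem mem_elementaryDivisors_iff {q : R[X]} : q ∈ elementaryDivisors c ↔
    ∃ (p : R[X]) (k : ℕ), p.Monic ∧ Irreducible p ∧ q = p ^ (k + 1) ∧
      ∃ y : matrixModule c, IsLevelGenerator p k y := by
  classical
  constructor
  · rintro ⟨r, p, e, hpe, ⟨φ⟩, i, rfl⟩
    obtain ⟨k, hk⟩ : ∃ k, e i = k + 1 := ⟨e i - 1, by have := (hpe i).2.2; omega⟩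
    exact ⟨p i, k, (hpe i).1, (hpe i).2.1, by rw [hk], _, isLevelGenerator_single
      (φ.trans (DirectSum.linearEquivFunOnFintype R[X] (Fin r) _)) (fun i => (hpe i).2.1) hk⟩
  · rintro ⟨p, k, hm, hp, rfl, y, hy⟩
    obtain ⟨r, p', e, hpe, ⟨φ⟩⟩ := exists_primaryDecomposition (isTorsion_matrixModule c)
    have hnorm : ∀ i, Associated (p' i) (normalize (p' i)) := fun i =>
      (normalize_associated (p' i)).symm
    have hspan : ∀ i, Ideal.span {p' i ^ e i} = Ideal.span {normalize (p' i) ^ e i} := fun i => by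
      rw [Ideal.span_singleton_eq_span_singleton]
      exact (hnorm i).pow_pow
    obtain ⟨i, hass, he, -⟩ := hy.exists_component φ (fun i => (hpe i).1) hp
    refine ⟨r, fun i => normalize (p' i), e, fun i => ⟨monic_normalize (hpe i).1.ne_zero,
      (hnorm i).irreducible (hpe i).1, (hpe i).2⟩, ⟨?_⟩, i, ?_⟩
    · exact (φ.trans (LinearEquiv.piCongrRight fun i =>
        Submodule.quotEquivOfEq _ _ (hspan i))).trans
          (DirectSum.linearEquivFunOnFintype R[X] (Fin r) _).symm
    · rw [he, eq_of_monic_of_associated hm (monic_normalize (hpe i).1.ne_zero)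
        (hass.trans (hnorm i))]

theorem pow_succ_mem_elementaryDivisors_iff {f : R[X]} (hm : f.Monic) (hf : Irreducible f) {k : ℕ} :
    f ^ (k + 1) ∈ elementaryDivisors c ↔ ∃ y : matrixModule c, IsLevelGenerator f k y := by
  rw [mem_elementaryDivisors_iff]
  constructor
  · rintro ⟨p, l, hpm, hp, heq, hy⟩
    obtain ⟨rfl, hle⟩ := eq_and_eq_of_pow_eq_pow hm hf hpm hp heq.dvd
    obtain ⟨-, hle'⟩ := eq_and_eq_of_pow_eq_pow hm hf hm hf heq.symm.dvd
    obtain rfl : k = l := by omega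
    exact hy
  · exact fun hy => ⟨f, k, hm, hf, rfl, hy⟩

theorem mem_powerIndices_pow_iff {f : R[X]} (hm : f.Monic) (hf : Irreducible f) {i j : ℕ}
    (hi : i ≠ 0) : j ∈ powerIndices c (f ^ i) ↔
      ∃ k, j = k + 1 ∧ ∃ y : matrixModule c, IsLevelGenerator f k y := by
  rw [powerIndices, Set.Finite.mem_toFinset, Set.mem_ofPred_eq]
  constructor
  · rintro ⟨hj, p, hp, hpf, hpj⟩
    obtain ⟨k, rfl⟩ : ∃ k, j = k + 1 := ⟨j - 1, by omega⟩
    refine ⟨k, rfl, ?_⟩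
    obtain ⟨p', l, hpm', hp', heq, y, hy⟩ := mem_elementaryDivisors_iff.mp hpj
    have h1 : Associated p f := hp.associated_of_dvd hf (hp.prime.dvd_of_dvd_pow hpf)
    have h2 : Associated p p' := hp.associated_of_dvd hp'
      (hp.prime.dvd_of_dvd_pow ((dvd_pow_self p (Nat.succ_ne_zero k)).trans heq.dvd))
    obtain rfl : f = p' := eq_of_monic_of_associated hm hpm' (h1.symm.trans h2)
    have h3 : Associated (f ^ (k + 1)) (f ^ (l + 1)) := (h1.symm.pow_pow).trans (heq ▸ .refl _)
    have h4 := (eq_and_eq_of_pow_eq_pow hm hf hm hf h3.dvd).2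
    have h5 := (eq_and_eq_of_pow_eq_pow hm hf hm hf h3.symm.dvd).2
    obtain rfl : k = l := by omega
    exact ⟨y, hy⟩
  · rintro ⟨k, rfl, hy⟩
    exact ⟨Nat.succ_pos k, f, hf, dvd_pow_self f hi,
      (pow_succ_mem_elementaryDivisors_iff hm hf).mpr hy⟩

theorem ne_zero_of_pow_mem_elementaryDivisors {f : R[X]} {i : ℕ}
    (h : f ^ i ∈ elementaryDivisors c) : i ≠ 0 := by
  rintro rfl
  obtain ⟨p, k, -, hp, h1, -⟩ := mem_elementaryDivisors_iff.mp h
  rw [pow_zero] at h1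
  exact hp.not_isUnit (isUnit_of_dvd_one (h1 ▸ dvd_pow_self p (Nat.succ_ne_zero k)))

theorem exists_pow_mem_maxElementaryDivisors {f : R[X]} (hm : f.Monic) (hf : Irreducible f) {k : ℕ}
    {y : matrixModule c} (hy : IsLevelGenerator f k y) :
    ∃ i, f ^ i ∈ maxElementaryDivisors c := by
  have hmem : ∀ {j}, j ∈ powerIndices c (f ^ 1) ↔ _ := mem_powerIndices_pow_iff hm hf one_ne_zero
  obtain ⟨j, hj, hsup⟩ := Finset.exists_mem_eq_sup (powerIndices c (f ^ 1))
    ⟨k + 1, hmem.mpr ⟨k, rfl, y, hy⟩⟩ (id : ℕ → ℕ)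
  have hsup' : (powerIndices c (f ^ 1)).sup id = j := hsup
  obtain ⟨l, rfl, hl⟩ := hmem.mp hj
  refine ⟨l + 1, (pow_succ_mem_elementaryDivisors_iff hm hf).mpr hl, ?_⟩
  rintro g hg hdvd
  obtain ⟨p, i, hpm, hp, rfl, hpy⟩ := mem_elementaryDivisors_iff.mp hg
  obtain ⟨rfl, hle⟩ := eq_and_eq_of_pow_eq_pow hm hf hpm hp hdvd
  have hle' : i + 1 ≤ l + 1 := by
    rw [← hsup']
    exact Finset.le_sup (f := (id : ℕ → ℕ)) (hmem.mpr ⟨i, rfl, hpy⟩)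
  rw [le_antisymm hle' hle]

theorem mem_powerIndicesIrred_iff {f : R[X]} (hm : f.Monic) (hf : Irreducible f) {j : ℕ} :
    j ∈ powerIndicesIrred c f ↔
      ∃ k, j = k + 1 ∧ ∃ y : matrixModule c, IsLevelGenerator f k y := by
  rw [powerIndicesIrred]
  split_ifs with h
  · exact mem_powerIndices_pow_iff hm hf (ne_zero_of_pow_mem_elementaryDivisors h.choose_spec.1)
  · refine ⟨fun h => absurd h (Finset.notMem_empty j), ?_⟩
    rintro ⟨k, -, y, hy⟩
    exact absurd (exists_pow_mem_maxElementaryDivisors hm hf hy) h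

theorem zero_notMem_powerIndicesIrred {f : R[X]} (hm : f.Monic) (hf : Irreducible f) :
    0 ∉ powerIndicesIrred c f := by
  rw [mem_powerIndicesIrred_iff hm hf]
  rintro ⟨k, hk, -⟩
  exact Nat.succ_ne_zero k hk.symm

theorem mem_irredSet_iff {f : R[X]} (hm : f.Monic) (hf : Irreducible f) :
    f ∈ irredSet c ↔ (powerIndicesIrred c f).card ≠ (powerIndicesIrred c f).sup id := by
  have heq : ∀ {i}, f ^ i ∈ maxElementaryDivisors c →
      powerIndices c (f ^ i) = powerIndicesIrred c f := fun {i} hi => by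
    ext j
    rw [mem_powerIndices_pow_iff hm hf (ne_zero_of_pow_mem_elementaryDivisors hi.1),
      mem_powerIndicesIrred_iff hm hf]
  constructor
  · rintro ⟨-, -, i, hi, hne⟩
    rwa [heq hi] at hne
  · intro hne
    obtain ⟨j, hj⟩ : (powerIndicesIrred c f).Nonempty := by
      rw [Finset.nonempty_iff_ne_empty]
      intro h0
      rw [h0] at hne
      exact hne rfl
    obtain ⟨k, -, y, hy⟩ := (mem_powerIndicesIrred_iff hm hf).mp hj
    obtain ⟨i, hi⟩ := exists_pow_mem_maxElementaryDivisors hm hf hy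
    exact ⟨hm, hf, i, hi, by rwa [heq hi]⟩

/-! ### Invariants of `Sg`-equivalence -/

theorem isQuasiHereditary_iff_irredSet_eq_empty :
    IsQuasiHereditary (centralizerAlgebra c) ↔ irredSet c = ∅ := by
  classical
  have hM := isTorsion_matrixModule c
  have hA := isFullEnd_centralizerAlgebra c
  rw [Set.eq_empty_iff_forall_notMem]
  constructor
  · intro hQ f hf
    refine (mem_irredSet_iff hf.1 hf.2.1).mp hf ?_
    have hmem := fun j => mem_powerIndicesIrred_iff (c := c) hf.1 hf.2.1 (j := j)
    -- without gaps the set of power indices is an initial segment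
    suffices h : powerIndicesIrred c f = Finset.Icc 1 ((powerIndicesIrred c f).sup id) by
      conv_lhs => rw [h]
      rw [Nat.card_Icc, Nat.add_sub_cancel]
    ext j
    rw [Finset.mem_Icc]
    constructor
    · intro hj
      refine ⟨?_, Finset.le_sup (f := (id : ℕ → ℕ)) hj⟩
      obtain ⟨k, rfl, -⟩ := (hmem j).mp hj
      exact Nat.succ_pos k
    · rintro ⟨hj1, hj⟩
      obtain ⟨i, hi, hsup⟩ := Finset.exists_mem_eq_sup (powerIndicesIrred c f) (by
        rw [Finset.nonempty_iff_ne_empty]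
        intro h0
        rw [h0, Finset.sup_empty] at hj
        exact absurd (hj1.trans hj) (by simp)) (id : ℕ → ℕ)
      rw [hsup] at hj
      obtain ⟨k, rfl, y, hy⟩ := (hmem i).mp hi
      have hjk : j ≤ k + 1 := hj
      exact (hmem j).mpr ⟨j - 1, by omega,
        hA.exists_isLevelGenerator_of_isQuasiHereditary hM hQ hf.2.1 (by omega) hy⟩
  · intro h
    refine hA.isQuasiHereditary hM fun p hp k l hlk hk => ?_
    have hass := (normalize_associated p).symm
    have hm : (normalize p).Monic := monic_normalize hp.ne_zero
    have hf := hass.irreducible hp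
    have h1 := h (normalize p)
    rw [mem_irredSet_iff hm hf, not_not] at h1
    have h2 := eq_Icc_of_card_eq_sup (zero_notMem_powerIndicesIrred hm hf) h1
    obtain ⟨y, hy⟩ := hk
    have h3 : k + 1 ∈ powerIndicesIrred c (normalize p) :=
      (mem_powerIndicesIrred_iff hm hf).mpr ⟨k, rfl, y, hy.of_associated hass⟩
    have h4 : l + 1 ∈ powerIndicesIrred c (normalize p) := by
      rw [h2, Finset.mem_Icc] at h3 ⊢
      omega
    obtain ⟨l', hl', z, hz⟩ := (mem_powerIndicesIrred_iff hm hf).mp h4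
    obtain rfl : l = l' := by omega
    exact ⟨z, hz.of_associated hass.symm⟩

theorem cartanDet_eq_finprod :
    cartanDet (centralizerAlgebra c) = ∏ᶠ i : IrredClass c, (i.gaps.prod : ℤ) := by
  classical
  let F : Finset R[X] := (UniqueFactorizationMonoid.normalizedFactors
    (minpoly R (Matrix.toLin' c))).toFinset
  have hF : ∀ f, f ∈ F ↔ Irreducible f ∧ f.Monic ∧ f ∣ minpoly R (Matrix.toLin' c) := by
    intro f
    rw [Multiset.mem_toFinset,
      UniqueFactorizationMonoid.mem_normalizedFactors_iff' (minpoly_ne_zero' c)]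
    refine and_congr_right fun hf => and_congr_left fun _ =>
      ⟨fun h => h ▸ monic_normalize hf.ne_zero, fun h => h.normalize_eq_self⟩
  have hlevel : ∀ {f : R[X]}, f.Monic → Irreducible f → ∀ {k} {y : matrixModule c},
      IsLevelGenerator f k y → f ∈ F := fun {f} hm hf {k y} hy => (hF f).mpr ⟨hf, hm,
    (dvd_pow_self f (Nat.succ_ne_zero k)).trans
      (dvd_minpoly ((pow_succ_mem_elementaryDivisors_iff hm hf).mpr ⟨y, hy⟩))⟩
  rw [(isFullEnd_centralizerAlgebra c).cartanDet_eq (isTorsion_matrixModule c) F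
    (fun f hf => ((hF f).mp hf).1)
    (fun f hf g hg h => eq_of_monic_of_associated ((hF f).mp hf).2.1 ((hF g).mp hg).2.1 h)
    (fun p hp k ⟨y, hy⟩ => ⟨normalize p, hlevel (monic_normalize hp.ne_zero)
      ((normalize_associated p).symm.irreducible hp)
      (hy.of_associated (normalize_associated p).symm), (normalize_associated p).symm⟩)
    (powerIndicesIrred c)
    (fun f hf i => mem_powerIndicesIrred_iff ((hF f).mp hf).2.1 ((hF f).mp hf).1)]
  let _ : Fintype (irredSet c) := (finite_irredSet c).fintype
  have : Finite (IrredClass c) := Quotient.finite (irredSetoid c)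
  let _ : Fintype (IrredClass c) := Fintype.ofFinite _
  rw [finprod_eq_prod_of_fintype]
  let q : irredSet c → IrredClass c := Quotient.mk (irredSetoid c)
  have hgaps : ∀ i : IrredClass c, (i.gaps.prod : ℤ) =
      ∏ f : irredSet c with q f = i, ((gaps (powerIndicesIrred c f.1)).prod : ℤ) := by
    intro i
    rw [IrredClass.gaps, Multiset.prod_sum, Nat.cast_prod]
    simp_rw [prod_nontrivialGaps]
    convert! rfl
  rw [Finset.prod_congr rfl fun i _ => hgaps i, Finset.prod_fiberwise Finset.univ q
    fun f => ((gaps (powerIndicesIrred c f.1)).prod : ℤ)]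
  -- the irreducible factors outside `irredSet c` contribute the factor `1`
  rw [← Finset.prod_subtype (irredSet c).toFinset (fun f => Set.mem_toFinset)
    fun f => ((gaps (powerIndicesIrred c f)).prod : ℤ)]
  symm
  refine Finset.prod_subset (fun f hf => ?_) fun f hf hf' => ?_
  · rw [Set.mem_toFinset] at hf
    obtain ⟨hm, hi, i, hmax, -⟩ := hf
    exact (hF f).mpr ⟨hi, hm,
      (dvd_pow_self f (ne_zero_of_pow_mem_elementaryDivisors hmax.1)).trans (dvd_minpoly hmax.1)⟩
  · obtain ⟨hi, hm, -⟩ := (hF f).mp hf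
    rw [Set.mem_toFinset, mem_irredSet_iff hm hi, not_not] at hf'
    rw [prod_gaps_eq_one (zero_notMem_powerIndicesIrred hm hi) hf', Nat.cast_one]

theorem isEmpty_irredClass_iff : IsEmpty (IrredClass c) ↔ irredSet c = ∅ := by
  rw [← Set.isEmpty_coe_sort]
  exact ⟨fun h => ⟨fun f => h.false (Quotient.mk (irredSetoid c) f)⟩,
    fun h => ⟨fun i => Quotient.inductionOn i fun f => h.false f⟩⟩

end Matrices

end CentralizerMatrix

theorem corollary5p6 {R : Type*} [Field R] {n m : ℕ}
    (c : Matrix (Fin n) (Fin n) R) (d : Matrix (Fin m) (Fin m) R)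
    (h : CentralizerMatrix.SgEquivalent c d) :
    (CentralizerMatrix.IsQuasiHereditary (CentralizerMatrix.centralizerAlgebra c) ↔
      CentralizerMatrix.IsQuasiHereditary (CentralizerMatrix.centralizerAlgebra d)) ∧
    CentralizerMatrix.cartanDet (CentralizerMatrix.centralizerAlgebra c) =
      CentralizerMatrix.cartanDet (CentralizerMatrix.centralizerAlgebra d) := by
  obtain ⟨σ, hσ⟩ := h
  constructor
  · rw [CentralizerMatrix.isQuasiHereditary_iff_irredSet_eq_empty,
      CentralizerMatrix.isQuasiHereditary_iff_irredSet_eq_empty,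
      ← CentralizerMatrix.isEmpty_irredClass_iff, ← CentralizerMatrix.isEmpty_irredClass_iff,
      σ.isEmpty_congr]
  · rw [CentralizerMatrix.cartanDet_eq_finprod, CentralizerMatrix.cartanDet_eq_finprod,
      ← finprod_comp_equiv σ]
    exact finprod_congr fun i => by rw [(hσ i).2]
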